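/- **Definitions.** Let $p\ge 1$ be an integer and $x>0$ real. *Super-partitions.* For $1\le b\le p$, the super-partition $S_b$ with base $b$ is initially the list $x^{b/p},x^{(b+1)/p},\dots,x^{(b+p-1)/p}$. The operation merge-next replaces the neighbouring pair of entries whose sum is minimal by their sum (a list with one entry is left unchanged). *Periodic scheme.* Start with all $S_1,\dots,S_p$ in their initial state and $X_1=S_1$. Repeat $p-1$ times: for $i=1,\dots,p$ apply merge-next to $S_i$, let $X'$ be the length-$p$ prefix of the concatenation $S_1S_2\cdots S_p$, and if $X'$ differs from the last recorded configuration, record it as the next configuration. This gives a finite sequence $X_1,\dots,X_N$ of lists of $p$ positive weights. Write $\max X_i$, $\mathrm{avg}\,X_i$ and $\Sigma X_i$ for the maximum, the average and the sum of the entries of $X_i$. *Flow.* At time $t$ a volume $t$ of flow has arrived. A partitioning of it into $p$ parts is given by separators $0=s_0\le s_1\le\dots\le s_{p-1}\le s_p=t$; its bottleneck value is $\max_j (s_{j+1}-s_j)$, and $\mathrm{opt}_p(t)$ is the infimum of the bottleneck values of all such partitionings. A deterministic preemptive online algorithm for Flow has a partitioning in place at each time $t\ge 0$; separators may be inserted only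 at the current time and may be removed later, i.e. every inner separator in place at time $t$ at a position at most $s\le t$ was in place at time $s$. For a warm-up time $t_0>0$, the algorithm has competitive ratio at most $c$ if at every time $t\ge t_0$ its bottleneck value is at most $c\cdot\mathrm{opt}_p(t)$. The algorithm *runs the scheme from time $t_0$* if, with $\lambda_n=\frac{t_0}{\Sigma X_1}\left(\frac{\Sigma X_N}{\Sigma X_1}\right)^n$, for all $n\ge 0$ and $1\le i<N$ and all times $t$ with $\lambda_n\Sigma X_i\le t<\lambda_n\Sigma X_{i+1}$, the first $p-1$ parts have the weights $\lambda_n X_{i+1}[1],\dots,\lambda_n X_{i+1}[p-1]$ (the last part holds the rest). **Theorem.** One has $\left|\frac{\ln 2}{\sqrt2-1}-1.673\right|<0.0005$, and there is an absolute constant $C$ such that the following holds for every $p$ that is a power of two and for $x=2$. 1. Every configuration $X_i$ produced by the periodic scheme satisfies $$\frac{\max X_i}{\mathrm{avg}\,X_i}\le \frac{\ln 2}{\sqrt2-1}+\frac{C}{p}.$$ 2. For every warm-up time $t_0>0$ there is a deterministic preemptive online algorithm for Flow with $p$ parts which runs the scheme from time $t_0$, and whose competitive ratio is at most $\frac{p+4}{p}\cdot\max_j\frac{\max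 X_j}{\mathrm{avg}\,X_j}$ and also at most $\frac{\ln 2}{\sqrt2-1}+\frac{C}{p}$. -/

import Mathlib

open scoped NNReal

noncomputable section

/-! ## Super-partitions and the periodic scheme -/

/-- Replace the entries `j` and `j + 1` (counted from `0`) of a list of weights by their sum. -/
def mergeAt (l : List ℝ) (j : ℕ) : List ℝ :=
  l.take j ++ (l.getD j 0 + l.getD (j + 1) 0) :: l.drop (j + 2)

/-- One evolution step of a super-partition: merge the (leftmost) pair of neighbouring partitions
whose sum is minimal.  A list with fewer than two entries does not change. -/
def mergeNext (l : List ℝ) : List ℝ :=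
  match (List.range (l.length - 1)).argmin (fun j => l.getD j 0 + l.getD (j + 1) 0) with
  | none => l
  | some j => mergeAt l j

/-- The initial configuration `x^(b/p), x^((b+1)/p), …, x^((b+p-1)/p)` of the super-partition with
base `b`. -/
def superPartition (p : ℕ) (x : ℝ) (b : ℕ) : List ℝ :=
  (List.range p).map fun j => x ^ (((b + j : ℕ) : ℝ) / (p : ℝ))

/-- State of the periodic scheme: the current super-partitions `S_1, …, S_p`, and the
configurations `X_1, …, X_j` produced so far. -/
structure SchemeState where
  parts : List (List ℝ)
  configs : List (List ℝ)

/-- Initially `S_b` is the initial super-partition with base `b`, and `X_1 = S_1`. -/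
def schemeInit (p : ℕ) (x : ℝ) : SchemeState where
  parts := (List.range p).map fun i => superPartition p x (i + 1)
  configs := [superPartition p x 1]

open Classical in
/-- Body of the inner loop: advance the super-partition at position `i` (counted from `0`), and
record the length `p` prefix of `S_1, …, S_p` if it differs from the last recorded configuration. -/
def schemeStep (p : ℕ) (st : SchemeState) (i : ℕ) : SchemeState :=
  let parts' := st.parts.modify i mergeNext
  let X' := parts'.flatten.take p
  { parts := parts'
    configs := if st.configs.getLast? = some X' then st.configs else st.configs ++ [X'] }

/-- The list `X_1, X_2, …` of all configurations produced by the periodic scheme: `p - 1` rounds,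
in each of which the super-partitions `S_1, …, S_p` are advanced once, in this order. -/
def periodicScheme (p : ℕ) (x : ℝ) : List (List ℝ) :=
  ((List.range (p - 1)).foldl (fun st _ => (List.range p).foldl (schemeStep p) st)
    (schemeInit p x)).configs

/-- Maximum of a nonempty list of nonnegative reals. -/
def listMax (X : List ℝ) : ℝ := X.foldr max 0

/-- Average of a nonempty list of reals. -/
def listAvg (X : List ℝ) : ℝ := X.sum / (X.length : ℝ)

/-- The max-over-average ratio of a configuration. -/
def maxAvgRatio (X : List ℝ) : ℝ := listMax X / listAvg X

/-- The largest max-over-average ratio of a configuration of the scheme. -/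
def schemeRatio (p : ℕ) (x : ℝ) : ℝ := listMax ((periodicScheme p x).map maxAvgRatio)

/-! ## Partitioning a continuous online flow -/

/-- A partitioning into `p` parts of the flow that has arrived up to time `t`:
`0 = s_0 ≤ s_1 ≤ … ≤ s_{p-1} ≤ s_p = t`. -/
structure FlowPartition (p : ℕ) (t : ℝ) where
  sep : Fin (p + 1) → ℝ
  mono : Monotone sep
  sep_zero : sep 0 = 0
  sep_last : sep (Fin.last p) = t

/-- Weight of the part between the separators `s_j` and `s_{j+1}`. -/
def FlowPartition.weight {p : ℕ} {t : ℝ} (P : FlowPartition p t) (j : Fin p) : ℝ :=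
  P.sep j.succ - P.sep j.castSucc

/-- Weight of a heaviest part. -/
def FlowPartition.bottleneck {p : ℕ} {t : ℝ} (P : FlowPartition p t) : ℝ :=
  ⨆ j : Fin p, P.weight j

/-- The optimal bottleneck value for the flow of volume `t`. -/
def flowOpt (p : ℕ) (t : ℝ) : ℝ :=
  sInf (Set.range fun P : FlowPartition p t => P.bottleneck)

/-- A deterministic preemptive online algorithm for the flow problem.  The only unknown is the
stopping time, so the algorithm is the family of partitionings in place at the times `t ≥ 0`.
Separators can be inserted at the current time only, and can be removed: every inner separator in
place at time `t` whose position is at most `s ≤ t` was already in place at time `s`. -/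
structure FlowAlgorithm (p : ℕ) where
  conf : ∀ t : ℝ≥0, FlowPartition p (t : ℝ)
  online : ∀ s t : ℝ≥0, s ≤ t → ∀ i : Fin (p + 1), i ≠ 0 → i ≠ Fin.last p →
    (conf t).sep i ≤ (s : ℝ) →
      ∃ j : Fin (p + 1), j ≠ 0 ∧ j ≠ Fin.last p ∧ (conf s).sep j = (conf t).sep i

/-- The competitive ratio of the algorithm is at most `c`, with warm-up period `t₀`. -/
def FlowAlgorithm.IsCompetitive {p : ℕ} (A : FlowAlgorithm p) (t₀ : ℝ≥0) (c : ℝ) : Prop :=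
  ∀ t : ℝ≥0, t₀ ≤ t → (A.conf t).bottleneck ≤ c * flowOpt p (t : ℝ)

/-- The algorithm runs the periodic scheme from time `t₀` on.  The scheme is scaled so that the
total weight of its first configuration is `t₀`, and it is repeated forever, scaled in each
repetition by the quotient of the total weights of its last and its first configuration.  While the
volume lies between the total weights of two successive (scaled) configurations, the first `p - 1`
parts have the weights prescribed by the second one, and the last part holds the rest. -/
def FlowAlgorithm.RunsScheme {p : ℕ} (A : FlowAlgorithm p) (x : ℝ) (t₀ : ℝ≥0) : Prop :=
  let N := (periodicScheme p x).length
  let X : ℕ → List ℝ := fun i => (periodicScheme p x).getD i []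
  let scale : ℕ → ℝ := fun n => (t₀ : ℝ) / (X 0).sum * ((X (N - 1)).sum / (X 0).sum) ^ n
  ∀ n i : ℕ, i + 1 < N → ∀ t : ℝ≥0,
    scale n * (X i).sum ≤ (t : ℝ) → (t : ℝ) < scale n * (X (i + 1)).sum →
      ∀ j : Fin p, (j : ℕ) + 1 < p → (A.conf t).weight j = scale n * (X (i + 1)).getD (j : ℕ) 0

end

noncomputable section

/-! ## Merging neighbours in a list -/

/-! For x = 2 a super-partition is a geometric progression spanning less than a factor 2. So the
cheapest pair is always the leftmost unmerged one (`mergeNext_pairMerged`), and once all pairs are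
merged the result is again such a progression, with half as many terms (`geomWeight_pair`). The
whole state is thus described by a scale α, the number q = 2^j of terms at the start of the phase,
the number m of pairs merged since then, and the number i of super-partitions already advanced in
the current round. At the end q = 1: the concatenation is a multiple of S_1, so the scheme can be
repeated forever.

Ratio. Merging preserves the sum α·2^(b/p)/(2^(1/q) − 1) of S_b. For bounded q, a configuration at
the start of a round consists of about w = p/(q − m) super-partitions, so its total is about
αp(2^(w/p) − 1)/(ln 2·(2^(1/q) − 1)). Its weights are bounded by about α·2^(2m/q)(1 + 2^(1/q)), the
next pair to be merged. This gives the ratio ln 2·2^(2m/q)(2^(2/q) − 1)/(2^(1/(q−m)) − 1), which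
equals ln 2/(√2 − 1) for q = 2, m = 0. No other round gives more (`round_ratio_le`), and the bound
does not increase within a round (`ratio_decreases`). The rounding errors are O(1/p) while q ≤ 1024
(`weightBound_le_of_few`); for larger q cruder estimates leave enough slack
(`weightBound_le_of_many`).

Algorithm. Each newly recorded configuration arises from the previous one by the arrival of a weight
of at most four times the average (`next_weight_le`) and one merge (`FlowStep`). Hence separators
are only removed, or inserted at the current time. Between two configurations the bottleneck is at
most the maximum of the later one, the total grows by a factor of at most (p + 4)/p, and the optimum
at time t is at least t/p. -/

theorem mergeAt_cons_succ (a : ℝ) (l : List ℝ) (j : ℕ) :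
    mergeAt (a :: l) (j + 1) = a :: mergeAt l j := by
  simp [mergeAt]

theorem mergeAt_append_right (l₁ l : List ℝ) (j : ℕ) :
    mergeAt (l₁ ++ l) (l₁.length + j) = l₁ ++ mergeAt l j := by
  induction l₁ with
  | nil => simp
  | cons a l₁ ih =>
    rw [List.length_cons, add_right_comm, List.cons_append, mergeAt_cons_succ, ih,
      List.cons_append]

theorem mergeAt_append_left (l l₂ : List ℝ) (j : ℕ) (h : j + 1 < l.length) :
    mergeAt (l ++ l₂) j = mergeAt l j ++ l₂ := by
  induction l generalizing j with
  | nil => simp at h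
  | cons a l ih =>
    cases j with
    | zero =>
      cases l with
      | nil => simp at h
      | cons b l => simp [mergeAt]
    | succ j =>
      rw [List.cons_append, mergeAt_cons_succ, mergeAt_cons_succ, ih j (by simpa using h),
        List.cons_append]

theorem length_mergeAt {l : List ℝ} {j : ℕ} (h : j + 1 < l.length) :
    (mergeAt l j).length = l.length - 1 := by
  simp [mergeAt]
  omega

theorem sum_mergeAt {l : List ℝ} {j : ℕ} (h : j + 1 < l.length) :
    (mergeAt l j).sum = l.sum := by
  induction l generalizing j with
  | nil => simp at h
  | cons a l ih =>
    cases j with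
    | zero =>
      cases l with
      | nil => simp at h
      | cons b l => simp [mergeAt, add_assoc]
    | succ j =>
      rw [mergeAt_cons_succ, List.sum_cons, ih (by simpa using h), List.sum_cons]

/-- A merge inside the prefix makes room for exactly one more entry: this is why a change of the
configuration is an arrival followed by a merge. -/
theorem take_mergeAt_of_lt {l : List ℝ} {j k : ℕ} (hj : j < k) (hk : k < l.length) :
    (mergeAt l j).take k = mergeAt (l.take (k + 1)) j := by
  have hlen : j + 1 < (l.take (k + 1)).length := by simp; omega
  conv_lhs => rw [← List.take_append_drop (k + 1) l]
  rw [mergeAt_append_left _ _ _ hlen]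
  have : (mergeAt (l.take (k + 1)) j).length = k := by
    rw [length_mergeAt hlen]; simp; omega
  exact List.take_left' this

theorem take_mergeAt_of_le {l : List ℝ} {j k : ℕ} (hj : k ≤ j) (hk : j < l.length) :
    (mergeAt l j).take k = l.take k := by
  rw [mergeAt, List.take_append_of_le_length (by simp; omega), List.take_take, min_eq_left hj]

/-- Prefix sums are separator positions. A merge deletes one of them and creates none. -/
theorem sum_take_mergeAt {l : List ℝ} {j i : ℕ} (hj : j + 1 < l.length) (hi : i < l.length) :
    ((mergeAt l j).take i).sum = (l.take (if i ≤ j then i else i + 1)).sum := by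
  split_ifs with h
  · rw [take_mergeAt_of_le h (by omega)]
  · rw [take_mergeAt_of_lt (by omega) hi, sum_mergeAt (by simp; omega)]

theorem flatten_modify_mergeAt (ls : List (List ℝ)) (i j : ℕ) (hi : i < ls.length)
    (hj : j + 1 < ls[i].length) :
    (ls.modify i fun l => mergeAt l j).flatten =
      mergeAt ls.flatten ((ls.take i).flatten.length + j) := by
  induction ls generalizing i with
  | nil => simp at hi
  | cons l ls ih =>
    cases i with
    | zero =>
      simp only [List.modify_zero_cons, List.flatten_cons, List.take_zero, List.flatten_nil,
        List.length_nil, zero_add]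
      exact (mergeAt_append_left _ _ _ hj).symm
    | succ i =>
      simp only [List.modify_succ_cons, List.flatten_cons, List.take_succ_cons,
        List.length_append]
      rw [ih i (by simpa using hi) (by simpa using hj), add_assoc, mergeAt_append_right]

/-- A proper prefix of a concatenation of lists ends in one of these lists. -/
theorem exists_take_flatten {α : Type*} (f : ℕ → List α) (N k : ℕ)
    (hk : k < (((List.range N).map f).flatten).length) :
    ∃ w n, w < N ∧ ∃ hn : n < (f w).length,
      k = (((List.range w).map f).flatten).length + n ∧
      (((List.range N).map f).flatten).take k =
        ((List.range w).map f).flatten ++ (f w).take n ∧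
      (((List.range N).map f).flatten)[k] = (f w)[n] := by
  induction N with
  | zero => simp at hk
  | succ N ih =>
    have hsplit : ((List.range (N + 1)).map f).flatten =
        ((List.range N).map f).flatten ++ f N := by
      simp [List.range_succ]
    by_cases h : k < (((List.range N).map f).flatten).length
    · obtain ⟨w, n, hw, hn, h1, h2, h3⟩ := ih h
      refine ⟨w, n, by omega, hn, h1, ?_, ?_⟩
      · rw [hsplit, List.take_append_of_le_length h.le, h2]
      · rw [← h3]
        simp only [hsplit]
        exact List.getElem_append_left h
    · push Not at h
      obtain ⟨n, rfl⟩ := Nat.exists_eq_add_of_le h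
      rw [hsplit, List.length_append] at hk
      refine ⟨N, n, by omega, by omega, rfl, ?_, ?_⟩
      · rw [hsplit, List.take_length_add_append]
      · simp only [hsplit]
        rw [List.getElem_append_right (by omega)]
        simp

theorem listMax_le {X : List ℝ} {c : ℝ} (hc : 0 ≤ c) (h : ∀ a ∈ X, a ≤ c) : listMax X ≤ c := by
  induction X with
  | nil => simpa [listMax] using hc
  | cons a X ih =>
    simp only [listMax, List.foldr_cons, max_le_iff]
    exact ⟨h a (by simp), ih fun b hb => h b (by simp [hb])⟩

theorem le_listMax {X : List ℝ} {a : ℝ} (h : a ∈ X) : a ≤ listMax X := by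
  induction X with
  | nil => simp at h
  | cons b X ih =>
    simp only [listMax, List.foldr_cons]
    rcases List.mem_cons.1 h with rfl | h
    · exact le_max_left _ _
    · exact (ih h).trans (le_max_right _ _)

/-! ## Geometric-like lists in which the first pairs have been merged -/

/-- The list `a 0, …, a (q - 1)`, after the first `m` disjoint pairs have been merged. -/
def pairMerged (a : ℕ → ℝ) (q m : ℕ) : List ℝ :=
  (List.range (q - m)).map fun j => if j < m then a (2 * j) + a (2 * j + 1) else a (m + j)

@[simp] theorem length_pairMerged (a : ℕ → ℝ) (q m : ℕ) : (pairMerged a q m).length = q - m := by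
  simp [pairMerged]

theorem getElem_pairMerged (a : ℕ → ℝ) (q m j : ℕ) (h : j < (pairMerged a q m).length) :
    (pairMerged a q m)[j] = if j < m then a (2 * j) + a (2 * j + 1) else a (m + j) := by
  simp [pairMerged]

theorem mergeAt_pairMerged (a : ℕ → ℝ) {q m : ℕ} (hm : 2 * m + 2 ≤ q) :
    mergeAt (pairMerged a q m) m = pairMerged a q (m + 1) := by
  have hl : m + 1 < (pairMerged a q m).length := by simp; omega
  apply List.ext_getElem
  · rw [length_mergeAt hl]; simp; omega
  · intro j h1 h2
    rw [getElem_pairMerged]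
    simp only [length_pairMerged] at h2 hl
    simp only [mergeAt]
    rcases lt_trichotomy j m with h | rfl | h
    · rw [List.getElem_append_left (by simp; omega), List.getElem_take, getElem_pairMerged,
        if_pos h, if_pos (by omega)]
    · rw [List.getElem_append_right (by simp)]
      have : j - ((pairMerged a q j).take j).length = 0 := by simp; omega
      simp only [this, List.getElem_cons_zero]
      rw [List.getD_eq_getElem _ _ (by simp; omega), List.getD_eq_getElem _ _ (by simp; omega),
        getElem_pairMerged, getElem_pairMerged, if_neg (by omega), if_neg (by omega),
        if_pos (by omega)]
      congr 2 <;> ring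
    · rw [List.getElem_append_right (by simp; omega)]
      have : j - ((pairMerged a q m).take m).length = (j - m - 1) + 1 := by simp; omega
      simp only [this, List.getElem_cons_succ]
      rw [List.getElem_drop, getElem_pairMerged, if_neg (by omega), if_neg (by omega)]
      congr 1; omega

/-- Two adjacent entries of which at least one is already a merged pair sum to more than `a (2 * m)
+ a (2 * m + 1)`, because every term is below twice the smallest one; later unmerged pairs lose by
monotonicity. The minimum is unique, so the tie-breaking rule plays no role. -/
theorem mergeNext_pairMerged {a : ℕ → ℝ} {q m : ℕ} (ha : StrictMono a)
    (h2 : ∀ k < q, a k < 2 * a 0) (hm : 2 * m + 2 ≤ q) :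
    mergeNext (pairMerged a q m) = pairMerged a q (m + 1) := by
  have key : (List.range ((pairMerged a q m).length - 1)).argmin
      (fun j => (pairMerged a q m).getD j 0 + (pairMerged a q m).getD (j + 1) 0) = some m := by
    have hmem : m ∈ List.range ((pairMerged a q m).length - 1) := by simp; omega
    cases hx : (List.range ((pairMerged a q m).length - 1)).argmin
      (fun j => (pairMerged a q m).getD j 0 + (pairMerged a q m).getD (j + 1) 0) with
    | none => rw [List.argmin_eq_none] at hx; rw [hx] at hmem; simp at hmem
    | some x =>
      have hle := List.le_of_mem_argmin hmem hx
      have hxm := List.argmin_mem hx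
      simp only [List.mem_range, length_pairMerged] at hxm
      rw [List.getD_eq_getElem _ _ (by simp; omega), List.getD_eq_getElem _ _ (by simp; omega),
        List.getD_eq_getElem _ _ (by simp; omega), List.getD_eq_getElem _ _ (by simp; omega)] at hle
      simp only [getElem_pairMerged] at hle
      rw [if_neg (lt_irrefl m), if_neg (show ¬ m + 1 < m by omega)] at hle
      have hm1 := h2 (m + m) (by omega)
      have hm2 := h2 (m + (m + 1)) (by omega)
      have h0 := fun k => ha.monotone (Nat.zero_le k)
      rcases lt_trichotomy x m with h | rfl | h
      · exfalso
        rw [if_pos h] at hle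
        by_cases h' : x + 1 < m
        · rw [if_pos h'] at hle
          linarith [h0 (2 * x), h0 (2 * x + 1), h0 (2 * (x + 1)), h0 (2 * (x + 1) + 1)]
        · rw [if_neg h', show x + 1 = m by omega] at hle
          linarith [h0 (2 * x), h0 (2 * x + 1)]
      · rfl
      · exfalso
        rw [if_neg (by omega), if_neg (by omega)] at hle
        linarith [ha (show m + m < m + x by omega), ha (show m + (m + 1) < m + (x + 1) by omega)]
  rw [mergeNext, key, ← mergeAt_pairMerged a hm]

theorem pairMerged_half (a : ℕ → ℝ) (q : ℕ) :
    pairMerged a (2 * q) q = pairMerged (fun k => a (2 * k) + a (2 * k + 1)) q 0 := by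
  apply List.ext_getElem
  · simp; omega
  · intro j h1 h2
    simp only [length_pairMerged] at h2
    rw [getElem_pairMerged, getElem_pairMerged, if_pos (by omega), if_neg (by omega), zero_add]

theorem pairMerged_zero (a : ℕ → ℝ) (q : ℕ) : pairMerged a q 0 = (List.range q).map a := by
  simp [pairMerged]

theorem sum_pairMerged (a : ℕ → ℝ) {q m : ℕ} (hm : 2 * m ≤ q) :
    (pairMerged a q m).sum = ∑ k ∈ Finset.range q, a k := by
  induction m with
  | zero =>
    rw [pairMerged_zero]
    clear hm
    induction q with
    | zero => simp
    | succ q ih => simp [List.range_succ, Finset.sum_range_succ, ih]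
  | succ m ih =>
    rw [← mergeAt_pairMerged a (by omega), sum_mergeAt (by simp; omega), ih (by omega)]

/-! ## The super-partitions during the periodic scheme -/

/-- The `k`-th weight of the super-partition with base `b + 1`, when it consists of `q` weights
in geometric progression. -/
def geomWeight (p : ℕ) (α : ℝ) (q b k : ℕ) : ℝ :=
  α * 2 ^ (((b + 1 : ℕ) : ℝ) / (p : ℝ)) * 2 ^ ((k : ℝ) / (q : ℝ))

/-- The super-partitions in a round of the scheme, when those at the first `i` positions have
been advanced. -/
def schemePart (p : ℕ) (α : ℝ) (q m i b : ℕ) : List ℝ :=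
  pairMerged (geomWeight p α q b) q (if b < i then m + 1 else m)

/-- All super-partitions in a round of the scheme, when the first `i` have been advanced. -/
def schemeParts (p : ℕ) (α : ℝ) (q m i : ℕ) : List (List ℝ) :=
  (List.range p).map (schemePart p α q m i)

theorem two_rpow_div_mono {q : ℕ} {i j : ℕ} (h : i ≤ j) :
    (2 : ℝ) ^ ((i : ℝ) / (q : ℝ)) ≤ 2 ^ ((j : ℝ) / (q : ℝ)) := by
  apply Real.rpow_le_rpow_of_exponent_le one_le_two
  gcongr

theorem one_le_two_rpow_div (q i : ℕ) : (1 : ℝ) ≤ 2 ^ ((i : ℝ) / (q : ℝ)) :=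
  Real.one_le_rpow one_le_two (by positivity)

theorem geomWeight_pos {p : ℕ} {α : ℝ} (hα : 0 < α) (q b k : ℕ) : 0 < geomWeight p α q b k := by
  unfold geomWeight; positivity

theorem geomWeight_strictMono {p : ℕ} {α : ℝ} (hα : 0 < α) {q : ℕ} (hq : 0 < q) (b : ℕ) :
    StrictMono (geomWeight p α q b) := by
  intro i j h
  unfold geomWeight
  have : (0 : ℝ) < q := by exact_mod_cast hq
  have h' : (i : ℝ) < j := by exact_mod_cast h
  exact mul_lt_mul_of_pos_left (Real.rpow_lt_rpow_of_exponent_lt one_lt_two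
    (div_lt_div_of_pos_right h' this)) (by positivity)

theorem geomWeight_lt {p : ℕ} {α : ℝ} (hα : 0 < α) {q b k : ℕ} (hk : k < q) :
    geomWeight p α q b k < 2 * geomWeight p α q b 0 := by
  unfold geomWeight
  have hq : (0 : ℝ) < q := by exact_mod_cast (by omega : 0 < q)
  have : (2 : ℝ) ^ ((k : ℝ) / (q : ℝ)) < 2 := by
    conv_rhs => rw [← Real.rpow_one 2]
    apply Real.rpow_lt_rpow_of_exponent_lt one_lt_two
    rw [div_lt_one hq]
    exact_mod_cast hk
  have h2 : (0 : ℝ) < α * 2 ^ (((b + 1 : ℕ) : ℝ) / (p : ℝ)) := by positivity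
  simp only [Nat.cast_zero, zero_div, Real.rpow_zero, mul_one]
  nlinarith

/-- The self-similarity of the scheme: summing consecutive terms of ratio 2^(1/(2q)) leaves a
progression of ratio 2^(1/q) and changes only the scale. -/
theorem geomWeight_pair (p : ℕ) (α : ℝ) {q : ℕ} (hq : 0 < q) (b k : ℕ) :
    geomWeight p α (2 * q) b (2 * k) + geomWeight p α (2 * q) b (2 * k + 1) =
      geomWeight p (α * (1 + 2 ^ (1 / ((2 * q : ℕ) : ℝ)))) q b k := by
  unfold geomWeight
  have hq' : (q : ℝ) ≠ 0 := by positivity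
  have h1 : ((2 * k : ℕ) : ℝ) / ((2 * q : ℕ) : ℝ) = (k : ℝ) / q := by
    push_cast; field_simp
  have h2 : ((2 * k + 1 : ℕ) : ℝ) / ((2 * q : ℕ) : ℝ) = (k : ℝ) / q + 1 / ((2 * q : ℕ) : ℝ) := by
    push_cast; field_simp
  rw [h1, h2, Real.rpow_add two_pos]
  ring

theorem superPartition_eq {p : ℕ} (b : ℕ) :
    superPartition p 2 (b + 1) = pairMerged (geomWeight p 1 p b) p 0 := by
  rw [pairMerged_zero, superPartition]
  apply List.map_congr_left
  intro j _
  rw [geomWeight, one_mul, ← Real.rpow_add two_pos]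
  congr 1
  push_cast; ring

theorem schemeInit_parts (p : ℕ) : (schemeInit p 2).parts = schemeParts p 1 p 0 0 := by
  simp only [schemeInit, schemeParts]
  apply List.map_congr_left
  intro b _
  rw [superPartition_eq, schemePart, if_neg (by omega)]

theorem mergeNext_schemePart {p : ℕ} {α : ℝ} (hα : 0 < α) {q m : ℕ} (hm : 2 * m + 2 ≤ q)
    (i : ℕ) : mergeNext (schemePart p α q m i i) = mergeAt (schemePart p α q m i i) m := by
  rw [schemePart, if_neg (lt_irrefl i), mergeNext_pairMerged
    (geomWeight_strictMono hα (by omega) i) (fun k hk => geomWeight_lt hα hk) hm,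
    mergeAt_pairMerged _ hm]

theorem length_schemePart (p : ℕ) (α : ℝ) (q m i b : ℕ) :
    (schemePart p α q m i b).length = if b < i then q - (m + 1) else q - m := by
  unfold schemePart
  split_ifs <;> simp

theorem schemeParts_modify {p : ℕ} {α : ℝ} (hα : 0 < α) {q m : ℕ} (hm : 2 * m + 2 ≤ q)
    (i : ℕ) : (schemeParts p α q m i).modify i mergeNext = schemeParts p α q m (i + 1) := by
  apply List.ext_getElem
  · simp [schemeParts]
  · intro b h1 h2
    rw [List.getElem_modify]
    simp only [schemeParts, List.getElem_map, List.getElem_range]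
    split_ifs with h
    · subst h
      rw [mergeNext_schemePart hα hm, schemePart, if_neg (lt_irrefl i), mergeAt_pairMerged _ hm,
        schemePart, if_pos (by omega)]
    · rw [schemePart, schemePart]
      congr 1
      split_ifs <;> omega

/-- The total number of weights in the first `w` super-partitions. -/
theorem length_flatten_schemePart (p : ℕ) (α : ℝ) {q m : ℕ} (hm : m + 1 ≤ q) (i w : ℕ) :
    (((List.range w).map (schemePart p α q m i)).flatten).length + min i w = w * (q - m) := by
  induction w with
  | zero => simp
  | succ w ih =>
    rw [List.range_succ, List.map_append, List.flatten_append, List.length_append,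
      List.map_singleton, List.flatten_singleton, length_schemePart, Nat.succ_mul, ← ih]
    split_ifs <;> omega

theorem flatten_schemeParts_succ {p : ℕ} {α : ℝ} (hα : 0 < α) {q m : ℕ} (hm : 2 * m + 2 ≤ q)
    {i : ℕ} (hi : i < p) :
    (schemeParts p α q m (i + 1)).flatten =
      mergeAt (schemeParts p α q m i).flatten
        ((((List.range i).map (schemePart p α q m i)).flatten).length + m) := by
  rw [← schemeParts_modify hα hm]
  have hmod : (schemeParts p α q m i).modify i mergeNext =
      (schemeParts p α q m i).modify i (fun l => mergeAt l m) := by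
    apply List.ext_getElem
    · simp
    · intro b h1 h2
      rw [List.getElem_modify, List.getElem_modify]
      split_ifs with h
      · subst h
        simp only [schemeParts, List.getElem_map, List.getElem_range]
        exact mergeNext_schemePart hα hm _
      · rfl
  rw [hmod, flatten_modify_mergeAt _ i m (by simpa [schemeParts] using hi)]
  · congr 3
    rw [schemeParts, ← List.map_take, List.take_range, min_eq_left hi.le]
  · simp only [schemeParts, List.getElem_map, List.getElem_range, length_schemePart]
    rw [if_neg (lt_irrefl i)]
    omega

theorem schemeParts_full {p : ℕ} {α : ℝ} (q m : ℕ) :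
    schemeParts p α q m p = schemeParts p α q (m + 1) 0 := by
  apply List.map_congr_left
  intro b hb
  rw [schemePart, schemePart, if_pos (List.mem_range.1 hb), if_neg (by omega)]

theorem schemeParts_half {p : ℕ} {α : ℝ} {q : ℕ} (hq : 0 < q) :
    schemeParts p α (2 * q) q 0 =
      schemeParts p (α * (1 + 2 ^ (1 / ((2 * q : ℕ) : ℝ)))) q 0 0 := by
  apply List.map_congr_left
  intro b hb
  rw [schemePart, schemePart, if_neg (by omega), if_neg (by omega), pairMerged_half]
  congr 1
  funext k
  exact geomWeight_pair p α hq b k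

theorem pos_of_mem_schemePart {p : ℕ} {α : ℝ} (hα : 0 < α) {q m i b : ℕ} :
    ∀ a ∈ schemePart p α q m i b, 0 < a := by
  intro a ha
  simp only [schemePart, pairMerged, List.mem_map] at ha
  obtain ⟨j, -, rfl⟩ := ha
  have h := geomWeight_pos (p := p) hα q b
  split_ifs <;> first | exact add_pos (h _) (h _) | exact h _

/-- Merging does not change the sum, so it is the full geometric sum, whose numerator is 2 − 1 = 1.
-/
theorem sum_schemePart {p : ℕ} {α : ℝ} {q m : ℕ} (hm : 2 * m + 2 ≤ q) (i b : ℕ) :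
    (schemePart p α q m i b).sum =
      α * 2 ^ (((b + 1 : ℕ) : ℝ) / (p : ℝ)) * (2 ^ (1 / (q : ℝ)) - 1)⁻¹ := by
  rw [schemePart, sum_pairMerged _ (by split_ifs <;> omega)]
  simp only [geomWeight]
  rw [← Finset.mul_sum]
  congr 1
  have hq : (0 : ℝ) < q := by exact_mod_cast (by omega : 0 < q)
  have h1 : (1 : ℝ) < 2 ^ (1 / (q : ℝ)) := Real.one_lt_rpow one_lt_two (by positivity)
  have hk : ∀ k : ℕ, (2 : ℝ) ^ ((k : ℝ) / (q : ℝ)) = (2 ^ (1 / (q : ℝ))) ^ k := by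
    intro k
    rw [← Real.rpow_natCast, ← Real.rpow_mul zero_le_two]
    congr 1; ring
  simp only [hk]
  rw [geom_sum_eq h1.ne', ← hk, div_self hq.ne', Real.rpow_one]
  norm_num

theorem sum_flatten_schemePart {p : ℕ} {α : ℝ} {q m : ℕ} (hm : 2 * m + 2 ≤ q) (i w : ℕ) :
    (((List.range w).map (schemePart p α q m i)).flatten).sum =
      α * (∑ b ∈ Finset.range w, 2 ^ (((b + 1 : ℕ) : ℝ) / (p : ℝ))) *
        (2 ^ (1 / (q : ℝ)) - 1)⁻¹ := by
  induction w with
  | zero => simp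
  | succ w ih =>
    rw [List.range_succ, List.map_append, List.flatten_append, List.sum_append, ih,
      List.map_singleton, List.flatten_singleton, sum_schemePart hm, Finset.sum_range_succ]
    ring

/-! ## Bounds for the weights -/

theorem two_rpow_le_one_add {x : ℝ} (h0 : 0 ≤ x) (h1 : x ≤ 1) : (2 : ℝ) ^ x ≤ 1 + x := by
  have := rpow_one_add_le_one_add_mul_self (s := 1) (by norm_num) h0 h1
  norm_num at this
  exact this

theorem nat_le_inv_two_rpow_sub_one {q : ℕ} (hq : 0 < q) :
    (q : ℝ) ≤ ((2 : ℝ) ^ (1 / (q : ℝ)) - 1)⁻¹ := by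
  have hq' : (0 : ℝ) < q := by exact_mod_cast hq
  have h1 : (1 : ℝ) < 2 ^ (1 / (q : ℝ)) := Real.one_lt_rpow one_lt_two (by positivity)
  have h2 : (2 : ℝ) ^ (1 / (q : ℝ)) ≤ 1 + 1 / q := by
    apply two_rpow_le_one_add (by positivity)
    rw [div_le_one hq']
    exact_mod_cast hq
  rw [le_inv_comm₀ hq' (by linarith), ← one_div]
  linarith

theorem sum_range_le_sum_take {l : List ℝ} {φ : ℕ → ℝ} (h : ∀ j (hj : j < l.length), φ j ≤ l[j])
    {n : ℕ} (hn : n ≤ l.length) : ∑ j ∈ Finset.range n, φ j ≤ (l.take n).sum := by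
  induction n with
  | zero => simp
  | succ n ih =>
    rw [Finset.sum_range_succ, List.sum_take_succ _ _ hn]
    exact add_le_add (ih (by omega)) (h n hn)

theorem sum_range_ite (m n : ℕ) (u v : ℝ) :
    ∑ j ∈ Finset.range n, (if j < m then u else v) = u * min n m + v * (n - min n m : ℕ) := by
  induction n with
  | zero => simp
  | succ n ih =>
    rw [Finset.sum_range_succ, ih]
    split_ifs with h
    · rw [min_eq_left (Nat.succ_le_of_lt h), min_eq_left h.le]
      simp; ring
    · push Not at h
      rw [min_eq_right h, min_eq_right (by omega), Nat.succ_sub h]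
      push_cast; ring

theorem getElem_schemePart {p : ℕ} {α : ℝ} {q m i b j : ℕ}
    (hj : j < (schemePart p α q m i b).length) :
    (schemePart p α q m i b)[j] = if j < (if b < i then m + 1 else m) then
      geomWeight p α q b (2 * j) + geomWeight p α q b (2 * j + 1) else
      geomWeight p α q b ((if b < i then m + 1 else m) + j) := by
  simp only [schemePart, getElem_pairMerged]

/-- A merged pair weighs at least twice the first term, and an unmerged term has index at least 2m.
The possible extra merge of an advanced super-partition only helps. -/
theorem le_getElem_schemePart {p : ℕ} {α : ℝ} (hα : 0 < α) {q m i b j : ℕ}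
    (hj : j < (schemePart p α q m i b).length) :
    α * 2 ^ (((b + 1 : ℕ) : ℝ) / (p : ℝ)) *
      (if j < m then 2 else 2 ^ (((2 * m : ℕ) : ℝ) / (q : ℝ))) ≤
      (schemePart p α q m i b)[j] := by
  rw [getElem_schemePart]
  unfold geomWeight
  have hc : 0 < α * 2 ^ (((b + 1 : ℕ) : ℝ) / (p : ℝ)) := by positivity
  set c := α * 2 ^ (((b + 1 : ℕ) : ℝ) / (p : ℝ))
  have h1 := one_le_two_rpow_div q (2 * j)
  have h2 := one_le_two_rpow_div q (2 * j + 1)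
  by_cases h : j < m
  · rw [if_pos h, if_pos (by split_ifs <;> omega)]
    nlinarith
  · rw [if_neg h]
    have h5 : (2 : ℝ) ^ (((2 * m : ℕ) : ℝ) / (q : ℝ)) ≤ 2 ^ (((2 * j : ℕ) : ℝ) / (q : ℝ)) :=
      two_rpow_div_mono (by omega)
    have h6 : (2 : ℝ) ^ (((2 * m : ℕ) : ℝ) / (q : ℝ)) ≤
        2 ^ (((((if b < i then m + 1 else m) + j : ℕ)) : ℝ) / (q : ℝ)) :=
      two_rpow_div_mono (by split_ifs <;> omega)
    split_ifs at h6 ⊢ <;> nlinarith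

/-- Lower bound for the total weight of a prefix of a super-partition. -/
theorem le_sum_take_schemePart {p : ℕ} {α : ℝ} (hα : 0 < α) {q m i b n : ℕ}
    (hn : n ≤ (schemePart p α q m i b).length) :
    α * 2 ^ (((b + 1 : ℕ) : ℝ) / (p : ℝ)) *
      (2 * (min n m : ℕ) + 2 ^ (((2 * m : ℕ) : ℝ) / (q : ℝ)) * (n - min n m : ℕ)) ≤
      ((schemePart p α q m i b).take n).sum := by
  rw [← sum_range_ite, Finset.mul_sum]
  exact sum_range_le_sum_take (fun j hj => le_getElem_schemePart hα hj) hn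

/-- The prefix of the concatenated super-partitions that consists of the first `w` of them and of
`n` weights of the next one. -/
def schemePrefix (p : ℕ) (α : ℝ) (q m i w n : ℕ) : List ℝ :=
  ((List.range w).map (schemePart p α q m i)).flatten ++ (schemePart p α q m i w).take n

theorem sum_schemePrefix_ge {p : ℕ} {α : ℝ} (hα : 0 < α) {q m i w n : ℕ} (hm : 2 * m + 2 ≤ q)
    (hn : n ≤ (schemePart p α q m i w).length) :
    α * ((∑ b ∈ Finset.range w, 2 ^ (((b + 1 : ℕ) : ℝ) / (p : ℝ))) *
        (2 ^ (1 / (q : ℝ)) - 1)⁻¹ + 2 ^ (((w + 1 : ℕ) : ℝ) / (p : ℝ)) *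
      (2 * (min n m : ℕ) + 2 ^ (((2 * m : ℕ) : ℝ) / (q : ℝ)) * (n - min n m : ℕ))) ≤
      (schemePrefix p α q m i w n).sum := by
  rw [schemePrefix, List.sum_append, sum_flatten_schemePart hm]
  have := le_sum_take_schemePart hα hn
  linarith

/-- A bound that does not see the different bases of the super-partitions. -/
theorem sum_schemePrefix_ge' {p : ℕ} {α : ℝ} (hα : 0 < α) {q m i w n : ℕ} (hm : 2 * m + 2 ≤ q)
    (hn : n ≤ (schemePart p α q m i w).length) :
    α * (2 ^ (1 / (p : ℝ)) * (w * (2 ^ (1 / (q : ℝ)) - 1)⁻¹ +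
      (2 * (min n m : ℕ) + 2 ^ (((2 * m : ℕ) : ℝ) / (q : ℝ)) * (n - min n m : ℕ)))) ≤
      (schemePrefix p α q m i w n).sum := by
  refine le_trans ?_ (sum_schemePrefix_ge hα hm hn)
  have hq := nat_le_inv_two_rpow_sub_one (show 0 < q by omega)
  have hb : ∀ b : ℕ, (2 : ℝ) ^ (1 / (p : ℝ)) ≤ 2 ^ (((b + 1 : ℕ) : ℝ) / (p : ℝ)) := by
    intro b
    have := two_rpow_div_mono (q := p) (show 1 ≤ b + 1 by omega)
    simpa using this
  have hs : (w : ℝ) * 2 ^ (1 / (p : ℝ)) ≤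
      ∑ b ∈ Finset.range w, 2 ^ (((b + 1 : ℕ) : ℝ) / (p : ℝ)) := by
    have := Finset.card_nsmul_le_sum (Finset.range w) _ _ (fun b _ => hb b)
    simpa using this
  apply mul_le_mul_of_nonneg_left _ hα.le
  rw [mul_add]
  apply add_le_add
  · rw [← mul_assoc, mul_comm ((2 : ℝ) ^ (1 / (p : ℝ)))]
    exact mul_le_mul_of_nonneg_right hs (by linarith [(Nat.cast_nonneg q : (0 : ℝ) ≤ q)])
  · exact mul_le_mul_of_nonneg_right (hb w) (by positivity)

/-- With y = 2m/q, the product (1 − y/2)(1 + y) is largest at y = 1/2, with value 9/8. The factor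
9/4 bounds 1 + 2^(1/q) for q ≥ 4. -/
theorem merged_weight_bound {p q w n m : ℝ} (hq0 : 0 < q) (hw0 : 0 ≤ w) (hn0 : 0 ≤ n)
    (hm0 : 0 ≤ m) (hmq : 2 * m ≤ q) (hp : p ≤ w * (q - m) + n) :
    p * ((1 + 2 * m / q) * (9 / 4)) ≤ 4 * (w * q + 2 * n) := by
  have hy : 2 * m / q ≤ 1 := by rwa [div_le_one hq0]
  have hy0 : 0 ≤ 2 * m / q := by positivity
  have hm : m = q * (2 * m / q) / 2 := by field_simp
  set y := 2 * m / q
  have h1 : (q - m) * (1 + y) ≤ q * (9 / 8) := by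
    rw [hm]
    nlinarith [mul_nonneg hq0.le (sq_nonneg (2 * y - 1))]
  have h2 : p * (1 + y) ≤ (w * (q - m) + n) * (1 + y) := by gcongr
  have h3 := mul_le_mul_of_nonneg_left h1 hw0
  have h4 := mul_nonneg hn0 (sub_nonneg.2 hy)
  have h5 := mul_nonneg hw0 hq0.le
  linarith

set_option maxHeartbeats 1000000 in
/-- Unless the step takes place beyond the prefix of length `p`, the weight that enters the
configuration is at most four times the average weight. -/
theorem next_weight_le {p : ℕ} {α : ℝ} (hα : 0 < α) {q m i : ℕ} (hm : 2 * m + 2 ≤ q)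
    (hlen : p < (schemeParts p α q m i).flatten.length)
    (hg : (((List.range i).map (schemePart p α q m i)).flatten).length + m < p) :
    p * (schemeParts p α q m i).flatten[p] ≤ 4 * ((schemeParts p α q m i).flatten.take p).sum := by
  obtain ⟨w, n, hw, hn, hp, htake, hget⟩ := exists_take_flatten (schemePart p α q m i) p p hlen
  have hlw := length_flatten_schemePart p α (show m + 1 ≤ q by omega) i w
  have hli := length_flatten_schemePart p α (show m + 1 ≤ q by omega) i i
  have hn' := hn
  rw [length_schemePart] at hn'
  -- The merge lies before position p, so the super-partition that contains entry p has not yet been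
  -- advanced in this round.
  have hiw : i ≤ w := by
    by_contra! h
    rw [if_pos h] at hn'
    have h1 : (w + 1) * (q - m) ≤ i * (q - m) := Nat.mul_le_mul_right _ h
    rw [Nat.succ_mul] at h1
    rw [min_self] at hli
    rw [min_eq_right h.le] at hlw
    have h2 : (w + 1) * (q - m) + i * 1 ≤ i * (q - m) + (w + 1) * 1 := by
      have hx : q - m = (q - m - 1) + 1 := by omega
      have := Nat.mul_le_mul_right (q - m - 1) (show w + 1 ≤ i from h)
      rw [hx, Nat.mul_add, Nat.mul_add]
      omega
    rw [Nat.succ_mul] at h2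
    omega
  rw [if_neg (by omega)] at hn'
  rw [min_eq_left hiw] at hlw
  have hsum : (schemeParts p α q m i).flatten.take p = schemePrefix p α q m i w n := htake
  have hge := sum_schemePrefix_ge' hα hm hn.le
  rw [hsum]
  have hq := nat_le_inv_two_rpow_sub_one (show 0 < q by omega)
  have hq0 : (0 : ℝ) < q := by exact_mod_cast (by omega : 0 < q)
  have hp0 : (0 : ℝ) < p := by exact_mod_cast (by omega : 0 < p)
  have hP : (1 : ℝ) ≤ 2 ^ (1 / (p : ℝ)) := by simpa using one_le_two_rpow_div p 1
  set P : ℝ := 2 ^ (1 / (p : ℝ))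
  set s : ℝ := ((2 : ℝ) ^ (1 / (q : ℝ)) - 1)⁻¹
  have hge2 : α * (P * (w * q + (2 * (min n m : ℕ) + (n - min n m : ℕ)))) ≤
      (schemePrefix p α q m i w n).sum := by
    refine le_trans ?_ hge
    have := one_le_two_rpow_div q (2 * m)
    have h0 : (0 : ℝ) ≤ (n - min n m : ℕ) := Nat.cast_nonneg _
    gcongr
    nlinarith
  have hpe : (p : ℝ) + i = w * (q - m) + n := by
    have : p + i = w * (q - m) + n := by omega
    have h2 := congrArg (Nat.cast (R := ℝ)) this
    rw [Nat.cast_add, Nat.cast_add, Nat.cast_mul, Nat.cast_sub (by omega)] at h2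
    exact h2
  have hi0 : (0 : ℝ) ≤ i := Nat.cast_nonneg _
  have hw0 : (0 : ℝ) ≤ w := Nat.cast_nonneg _
  have hm0 : (0 : ℝ) ≤ m := Nat.cast_nonneg _
  have hn0 : (0 : ℝ) ≤ n := Nat.cast_nonneg _
  have hget' : (schemeParts p α q m i).flatten[p] = (schemePart p α q m i w)[n] := hget
  rw [hget', getElem_schemePart, if_neg (show ¬ w < i by omega)]
  have hwp : (2 : ℝ) ^ (((w + 1 : ℕ) : ℝ) / (p : ℝ)) = P * 2 ^ ((w : ℝ) / (p : ℝ)) := by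
    rw [← Real.rpow_add two_pos]
    congr 1; push_cast; ring
  -- The entering weight is either a merged pair, whose exponent is controlled by 2m/q, or a single
  -- term, for which the crude bound 2·2 suffices.
  by_cases hnm : n < m
  · rw [if_pos hnm]
    rw [min_eq_left hnm.le, Nat.sub_self, Nat.cast_zero, add_zero] at hge2
    have hiw' : i < w ∨ i = w := by omega
    have hlt : i < w := by
      rcases hiw' with h | h
      · exact h
      · subst h; omega
    have hmq : (2 * m + 2 : ℝ) ≤ q := by exact_mod_cast hm
    have hwq : (w : ℝ) / p ≤ 2 / q := by
      rw [div_le_div_iff₀ hp0 hq0]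
      have : (i : ℝ) ≤ w := by exact_mod_cast hlt.le
      nlinarith
    have hq4 : (4 : ℝ) ≤ q := by exact_mod_cast (by omega : 4 ≤ q)
    have hE : (2 : ℝ) ^ ((w : ℝ) / p) * 2 ^ (((2 * n : ℕ) : ℝ) / q) ≤ 1 + 2 * m / q := by
      rw [← Real.rpow_add two_pos]
      have hx : (w : ℝ) / p + ((2 * n : ℕ) : ℝ) / q ≤ 2 * m / q := by
        have : ((2 * n : ℕ) : ℝ) / q ≤ (2 * m - 2) / q := by
          gcongr
          have : (n : ℝ) + 1 ≤ m := by exact_mod_cast hnm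
          push_cast; linarith
        have e : (2 * m - 2 : ℝ) / q = 2 * m / q - 2 / q := by ring
        linarith
      refine (Real.rpow_le_rpow_of_exponent_le one_le_two hx).trans ?_
      apply two_rpow_le_one_add (by positivity)
      rw [div_le_one hq0]; linarith
    have h119 : (2 : ℝ) ^ (1 / (q : ℝ)) ≤ 1 + 1 / 4 := by
      refine (two_rpow_le_one_add (by positivity) ?_).trans ?_
      · rw [div_le_one hq0]; linarith
      · gcongr
    have hsucc : (2 : ℝ) ^ (((2 * n + 1 : ℕ) : ℝ) / q) =
        2 ^ (((2 * n : ℕ) : ℝ) / q) * 2 ^ (1 / (q : ℝ)) := by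
      rw [← Real.rpow_add two_pos]; congr 1; push_cast; ring
    have hval : geomWeight p α q w (2 * n) + geomWeight p α q w (2 * n + 1) ≤
        α * P * ((1 + 2 * m / q) * (9 / 4)) := by
      rw [geomWeight, geomWeight, hwp, hsucc]
      have e : ∀ a b c d e : ℝ, a * (b * c) * d + a * (b * c) * (d * e) =
        a * b * ((c * d) * (1 + e)) := by intros; ring
      rw [e]
      gcongr
      linarith
    have hfin : (p : ℝ) * ((1 + 2 * m / q) * (9 / 4)) ≤ 4 * (w * q + 2 * n) :=
      merged_weight_bound hq0 hw0 hn0 hm0 (by linarith) (by linarith)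
    calc (p : ℝ) * (geomWeight p α q w (2 * n) + geomWeight p α q w (2 * n + 1))
        ≤ p * (α * P * ((1 + 2 * m / q) * (9 / 4))) := mul_le_mul_of_nonneg_left hval hp0.le
      _ = α * P * (p * ((1 + 2 * m / q) * (9 / 4))) := by ring
      _ ≤ α * P * (4 * (w * q + 2 * n)) := mul_le_mul_of_nonneg_left hfin (by positivity)
      _ = 4 * (α * (P * (w * q + 2 * n))) := by ring
      _ ≤ _ := by linarith
  · rw [if_neg hnm]
    have hnm' : (min n m : ℕ) = m := min_eq_right (by omega)
    rw [hnm', Nat.cast_sub (by omega)] at hge2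
    have h1 : (2 : ℝ) ^ ((w : ℝ) / p) ≤ 2 := by
      conv_rhs => rw [← Real.rpow_one 2]
      apply Real.rpow_le_rpow_of_exponent_le one_le_two
      rw [div_le_one hp0]; exact_mod_cast hw.le
    have h2 : (2 : ℝ) ^ (((m + n : ℕ) : ℝ) / q) ≤ 2 := by
      conv_rhs => rw [← Real.rpow_one 2]
      apply Real.rpow_le_rpow_of_exponent_le one_le_two
      rw [div_le_one hq0]; exact_mod_cast (by omega : m + n ≤ q)
    have hval : geomWeight p α q w (m + n) ≤ α * P * (2 * 2) := by
      rw [geomWeight, hwp]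
      have e : ∀ a b c d : ℝ, a * (b * c) * d = a * b * (c * d) := by intros; ring
      rw [e]
      gcongr
    have hfin : (p : ℝ) ≤ w * q + (2 * m + (n - m)) := by
      nlinarith [mul_nonneg hw0 hm0]
    calc (p : ℝ) * geomWeight p α q w (m + n) ≤ p * (α * P * (2 * 2)) :=
          mul_le_mul_of_nonneg_left hval hp0.le
      _ = 4 * (α * (P * p)) := by ring
      _ ≤ 4 * (α * (P * (w * q + (2 * m + (n - m))))) := by gcongr
      _ ≤ _ := by linarith

/-! ## Elementary inequalities for powers of two -/

theorem sqrt_two_bounds : 1.41421 < √2 ∧ √2 < 1.41422 := by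
  constructor
  · rw [Real.lt_sqrt (by norm_num)]; norm_num
  · rw [Real.sqrt_lt' (by norm_num)]; norm_num

theorem two_rpow_one_div_pow {n : ℕ} (hn : n ≠ 0) : ((2 : ℝ) ^ (1 / (n : ℝ))) ^ n = 2 := by
  rw [← Real.rpow_natCast, ← Real.rpow_mul zero_le_two, one_div_mul_cancel (by exact_mod_cast hn),
    Real.rpow_one]

theorem le_two_rpow_one_div {a : ℝ} {n : ℕ} (hn : n ≠ 0) (h : a ^ n ≤ 2) :
    a ≤ 2 ^ (1 / (n : ℝ)) :=
  le_of_pow_le_pow_left₀ hn (by positivity) (by rwa [two_rpow_one_div_pow hn])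

theorem two_rpow_one_div_le {a : ℝ} {n : ℕ} (hn : n ≠ 0) (ha : 0 ≤ a) (h : 2 ≤ a ^ n) :
    2 ^ (1 / (n : ℝ)) ≤ a :=
  le_of_pow_le_pow_left₀ hn ha (by rwa [two_rpow_one_div_pow hn])

/-- The limit of the max-over-average ratio. -/
def limitRatio : ℝ := Real.log 2 / (√2 - 1)

theorem limitRatio_eq : limitRatio = Real.log 2 * (√2 + 1) := by
  have h := sqrt_two_bounds.1
  have h2 : √2 ^ 2 = 2 := Real.sq_sqrt zero_le_two
  rw [limitRatio, div_eq_iff (by linarith)]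
  linear_combination (-Real.log 2) * h2

theorem limitRatio_bounds : 1.6733 < limitRatio ∧ limitRatio < 1.6735 := by
  rw [limitRatio_eq]
  have h1 := sqrt_two_bounds
  have h2 := Real.log_two_gt_d9
  have h3 := Real.log_two_lt_d9
  constructor <;> nlinarith

theorem abs_limitRatio_sub_lt : |limitRatio - 1.673| < 0.0005 := by
  have := limitRatio_bounds
  rw [abs_lt]
  constructor <;> linarith

theorem one_add_log_two_mul_le (x : ℝ) : 1 + Real.log 2 * x ≤ (2 : ℝ) ^ x := by
  rw [Real.rpow_def_of_pos two_pos]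
  linarith [Real.add_one_le_exp (Real.log 2 * x)]

theorem log_two_pos : 0 < Real.log 2 := Real.log_pos one_lt_two

theorem two_rpow_sub_one_le (x : ℝ) : (2 : ℝ) ^ x - 1 ≤ Real.log 2 * x * 2 ^ x := by
  have h := one_add_log_two_mul_le (-x)
  have h2 : (0 : ℝ) < 2 ^ x := by positivity
  have h3 : (2 : ℝ) ^ (-x) * 2 ^ x = 1 := by
    rw [← Real.rpow_add two_pos]; simp
  nlinarith

/-- Chords of `4 ^ y` on `[0, 1/4]` and `[1/4, 1/2]`. -/
theorem two_rpow_two_mul_le {y : ℝ} (h0 : 0 ≤ y) (h1 : y ≤ 1 / 2) :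
    (y ≤ 1 / 4 ∧ (2 : ℝ) ^ (2 * y) ≤ 1 + 1.66 * y) ∨
      (1 / 4 ≤ y ∧ (2 : ℝ) ^ (2 * y) ≤ 0.8283 + 2.344 * y) := by
  have hs := sqrt_two_bounds
  have h2 : √2 ^ 2 = 2 := Real.sq_sqrt zero_le_two
  have chord : ∀ x : ℝ, 0 ≤ x → x ≤ 1 / 4 → (2 : ℝ) ^ (2 * x) ≤ 1 + (√2 - 1) * (4 * x) := by
    intro x hx0 hx1
    have := rpow_one_add_le_one_add_mul_self (s := √2 - 1) (p := 4 * x) (by linarith)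
      (by linarith) (by linarith)
    rw [add_sub_cancel, Real.sqrt_eq_rpow, ← Real.rpow_mul zero_le_two] at this
    rw [← Real.sqrt_eq_rpow] at this
    convert this using 2 <;> ring
  rcases le_total y (1 / 4) with h | h
  · left
    refine ⟨h, (chord y h0 h).trans ?_⟩
    nlinarith
  · right
    refine ⟨h, ?_⟩
    have e : (2 : ℝ) ^ (2 * y) = √2 * 2 ^ (2 * (y - 1 / 4)) := by
      rw [Real.sqrt_eq_rpow, ← Real.rpow_add two_pos]; congr 1; ring
    rw [e]
    have hc := chord (y - 1 / 4) (by linarith) (by linarith)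
    have h3 := mul_le_mul_of_nonneg_left hc (Real.sqrt_nonneg 2)
    refine h3.trans ?_
    nlinarith

theorem two_rpow_two_mul_mul_le {y : ℝ} (h0 : 0 ≤ y) (h1 : y ≤ 1 / 2) :
    (2 : ℝ) ^ (2 * y) * (1 - y) ≤ 1.074 := by
  rcases two_rpow_two_mul_le h0 h1 with ⟨_, h⟩ | ⟨_, h⟩
  · have := mul_le_mul_of_nonneg_right h (by linarith : 0 ≤ 1 - y)
    -- The hint is (nearly) the vertex of the parabola obtained from the chord; likewise 0.3233 in
    -- the second case.
    nlinarith [sq_nonneg (y - 0.2)]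
  · have := mul_le_mul_of_nonneg_right h (by linarith : 0 ≤ 1 - y)
    nlinarith [sq_nonneg (y - 0.3233)]

/-- The ratio at the beginning of a round is at most the one at the beginning of the last
round. -/
theorem round_ratio_le {q m : ℕ} (hm : 2 * m + 2 ≤ q) (hq : q = 2 ∨ q = 4 ∨ 8 ≤ q) :
    (√2 - 1) * (2 ^ (((2 * m : ℕ) : ℝ) / (q : ℝ)) * (2 ^ (2 / (q : ℝ)) - 1)) ≤
      2 ^ (1 / ((q : ℝ) - m)) - 1 := by
  have hs := sqrt_two_bounds
  have h2 : √2 ^ 2 = 2 := Real.sq_sqrt zero_le_two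
  have hhalf : (2 : ℝ) ^ (1 / 2 : ℝ) = √2 := (Real.sqrt_eq_rpow 2).symm
  -- For q = 2, m = 0 both sides agree: this is the round that determines the constant.
  rcases hq with rfl | rfl | hq
  · obtain rfl : m = 0 := by omega
    norm_num
    rw [hhalf]
  · have : m = 0 ∨ m = 1 := by omega
    rcases this with rfl | rfl
    · have h4 : (1.18 : ℝ) ≤ 2 ^ (1 / 4 : ℝ) := by
        exact_mod_cast le_two_rpow_one_div (n := 4) (by norm_num) (by norm_num)
      norm_num
      norm_num at h4
      rw [hhalf]
      nlinarith
    · have h3 : (1.25 : ℝ) ≤ 2 ^ (1 / 3 : ℝ) := by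
        exact_mod_cast le_two_rpow_one_div (n := 3) (by norm_num) (by norm_num)
      norm_num
      norm_num at h3
      rw [hhalf]
      nlinarith
  -- For q ≥ 8 there is slack: the left side is bounded by the chord of 2^x on [0, 1/4], the right
  -- side by its tangent at 0, and 2^(2y)(1 − y) ≤ 1.074 with y = m/q links the two.
  · have hq' : (8 : ℝ) ≤ q := by exact_mod_cast hq
    have hm' : (2 * m + 2 : ℝ) ≤ q := by exact_mod_cast hm
    have hm0 : (0 : ℝ) ≤ m := Nat.cast_nonneg _
    have hlow := one_add_log_two_mul_le (1 / ((q : ℝ) - m))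
    have h4 : (2 : ℝ) ^ (1 / 4 : ℝ) ≤ 1.1893 := by
      exact_mod_cast two_rpow_one_div_le (n := 4) (by norm_num) (by norm_num) (by norm_num)
    have h41 : (1 : ℝ) ≤ (2 : ℝ) ^ (1 / 4 : ℝ) := Real.one_le_rpow one_le_two (by norm_num)
    have hup : (2 : ℝ) ^ (2 / (q : ℝ)) - 1 ≤ 0.1893 * (8 / q) := by
      have := rpow_one_add_le_one_add_mul_self (s := (2 : ℝ) ^ (1 / 4 : ℝ) - 1) (p := 8 / q)
        (by linarith) (by positivity) (by rw [div_le_one (by linarith)]; exact hq')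
      rw [add_sub_cancel, ← Real.rpow_mul zero_le_two] at this
      have e : (1 / 4 : ℝ) * (8 / q) = 2 / q := by ring
      rw [e] at this
      have h5 : ((2 : ℝ) ^ (1 / 4 : ℝ) - 1) * (8 / q) ≤ 0.1893 * (8 / q) := by
        gcongr; linarith
      linarith
    have hq0 : (0 : ℝ) < q := by linarith
    have hy := two_rpow_two_mul_mul_le (y := m / q) (by positivity)
      (by rw [div_le_div_iff₀ hq0 two_pos]; linarith)
    have e : (((2 * m : ℕ) : ℝ) / (q : ℝ)) = 2 * (m / q) := by push_cast; ring
    rw [e]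
    set E : ℝ := 2 ^ (2 * ((m : ℝ) / q))
    have hE : 0 < E := by positivity
    have hqm : (0 : ℝ) < q - m := by linarith
    have h6 : E * (q - m) ≤ 1.074 * q := by
      have : E * (q - m) = E * (1 - m / q) * q := by field_simp
      rw [this]; gcongr
    calc (√2 - 1) * (E * (2 ^ (2 / (q : ℝ)) - 1)) ≤ 0.41422 * (E * (0.1893 * (8 / q))) := by
          have : 0 ≤ (2 : ℝ) ^ (2 / (q : ℝ)) - 1 := by
            linarith [Real.one_le_rpow one_le_two (by positivity : 0 ≤ 2 / (q : ℝ))]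
          gcongr; linarith
      _ ≤ 0.69 * (1 / (q - m)) := by
          rw [mul_one_div, le_div_iff₀ hqm]
          have : 0.41422 * (E * (0.1893 * (8 / q))) * (q - m) =
            0.41422 * 0.1893 * 8 * (E * (q - m)) / q := by ring
          rw [this, div_le_iff₀ hq0]
          nlinarith
      _ ≤ Real.log 2 * (1 / (q - m)) := by
          gcongr; linarith [Real.log_two_gt_d9]
      _ ≤ _ := by linarith

/-- Within a round the ratio decreases. -/
theorem ratio_decreases {c β : ℝ} (hc : 0 ≤ c) (h0 : 0 ≤ β) (h1 : β ≤ 1) :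
    (2 : ℝ) ^ β * (2 ^ c - 1) ≤ 2 ^ ((1 + β) * c) - 1 := by
  have e : (2 : ℝ) ^ ((1 + β) * c) = 2 ^ c * 2 ^ (β * c) := by
    rw [← Real.rpow_add two_pos]; congr 1; ring
  rw [e]
  -- Both sides are compared with (1 + β)(2^c − 1): Bernoulli bounds the left side from above,
  -- tangents bound the right side from below.
  have h2 := two_rpow_le_one_add h0 h1
  have h3 := one_add_log_two_mul_le (β * c)
  have h4 := two_rpow_sub_one_le c
  have h5 : (1 : ℝ) ≤ 2 ^ c := Real.one_le_rpow one_le_two hc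
  have h6 : (2 : ℝ) ^ c * (Real.log 2 * (β * c)) ≤ 2 ^ c * (2 ^ (β * c) - 1) := by
    gcongr; linarith
  have h7 : (2 ^ β - 1) * ((2 : ℝ) ^ c - 1) ≤ β * (2 ^ c - 1) := by
    gcongr
    · linarith
  have h8 := mul_le_mul_of_nonneg_left h4 h0
  nlinarith

/-! ## The ratio of the configurations -/

/-- Up to the scale `α`, a bound for the weights in a configuration. -/
def weightBound (p q m i : ℕ) : ℝ :=
  2 ^ (((2 * m : ℕ) : ℝ) / (q : ℝ)) * (1 + 2 ^ (1 / (q : ℝ))) * 2 ^ (((i + 1 : ℕ) : ℝ) / (p : ℝ))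

theorem weightBound_pos (p q m i : ℕ) : 0 < weightBound p q m i := by
  unfold weightBound; positivity

/-- The reference weight is pair m of a super-partition with base about min i w + 1.
Super-partitions not yet advanced have larger bases, up to w + 1, but their last merged pair has
index m − 1, and the loss of 2/q in the exponent pays for the base. Unmerged terms may use an extra
1 in the exponent, since 1 + 2^(1/q) ≥ 2. -/
theorem le_of_mem_schemePart {p : ℕ} {α : ℝ} (hα : 0 < α) {q m i w b : ℕ} (hm : 2 * m + 2 ≤ q)
    (hp0 : 0 < p) (hp : w * (q - m) ≤ p + min i w) (hb : b ≤ w) :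
    ∀ a ∈ schemePart p α q m i b, a ≤ α * weightBound p q m (min i w) := by
  intro a ha
  obtain ⟨j, hj, rfl⟩ := List.getElem_of_mem ha
  have hj' := hj
  rw [length_schemePart] at hj'
  rw [getElem_schemePart, geomWeight, geomWeight, geomWeight, weightBound]
  have hp0' : (0 : ℝ) < p := by exact_mod_cast hp0
  have hq0 : (0 : ℝ) < q := by exact_mod_cast (by omega : 0 < q)
  have hsucc : (2 : ℝ) ^ (((2 * j + 1 : ℕ) : ℝ) / q) =
      2 ^ (((2 * j : ℕ) : ℝ) / q) * 2 ^ (1 / (q : ℝ)) := by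
    rw [← Real.rpow_add two_pos]; congr 1; push_cast; ring
  have h1q : (1 : ℝ) ≤ 2 ^ (1 / (q : ℝ)) := Real.one_le_rpow one_le_two (by positivity)
  have key1 : ∀ x y : ℕ, ((x : ℝ) / p + (y : ℝ) / q ≤
      ((min i w + 1 : ℕ) : ℝ) / p + ((2 * m : ℕ) : ℝ) / q) →
      (2 : ℝ) ^ ((x : ℝ) / p) * 2 ^ ((y : ℝ) / q) ≤
      2 ^ (((2 * m : ℕ) : ℝ) / (q : ℝ)) * 2 ^ (((min i w + 1 : ℕ) : ℝ) / (p : ℝ)) := by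
    intro x y h
    rw [← Real.rpow_add two_pos, ← Real.rpow_add two_pos]
    exact Real.rpow_le_rpow_of_exponent_le one_le_two (by linarith)
  have key2 : ∀ x y : ℕ, ((x : ℝ) / p + (y : ℝ) / q ≤
      ((min i w + 1 : ℕ) : ℝ) / p + ((2 * m : ℕ) : ℝ) / q + 1) →
      (2 : ℝ) ^ ((x : ℝ) / p) * 2 ^ ((y : ℝ) / q) ≤
      2 ^ (((2 * m : ℕ) : ℝ) / (q : ℝ)) * 2 ^ (((min i w + 1 : ℕ) : ℝ) / (p : ℝ)) * 2 := by
    intro x y h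
    rw [← Real.rpow_add two_pos, ← Real.rpow_add two_pos]
    conv_rhs => rw [← Real.rpow_one 2, ← Real.rpow_mul zero_le_two, one_mul,
      ← Real.rpow_add two_pos]
    exact Real.rpow_le_rpow_of_exponent_le one_le_two (by linarith)
  have fin1 : ∀ x y : ℕ, ((x : ℝ) / p + (y : ℝ) / q ≤
      ((min i w + 1 : ℕ) : ℝ) / p + ((2 * m : ℕ) : ℝ) / q) →
      α * (2 : ℝ) ^ ((x : ℝ) / p) * 2 ^ ((y : ℝ) / q) +
        α * (2 : ℝ) ^ ((x : ℝ) / p) * (2 ^ ((y : ℝ) / q) * 2 ^ (1 / (q : ℝ))) ≤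
      α * (2 ^ (((2 * m : ℕ) : ℝ) / (q : ℝ)) * (1 + 2 ^ (1 / (q : ℝ))) *
        2 ^ (((min i w + 1 : ℕ) : ℝ) / (p : ℝ))) := by
    intro x y h
    have := mul_le_mul_of_nonneg_left (key1 x y h)
      (by positivity : 0 ≤ α * (1 + (2 : ℝ) ^ (1 / (q : ℝ))))
    linarith
  have fin2 : ∀ x y : ℕ, ((x : ℝ) / p + (y : ℝ) / q ≤
      ((min i w + 1 : ℕ) : ℝ) / p + ((2 * m : ℕ) : ℝ) / q + 1) →
      α * (2 : ℝ) ^ ((x : ℝ) / p) * 2 ^ ((y : ℝ) / q) ≤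
      α * (2 ^ (((2 * m : ℕ) : ℝ) / (q : ℝ)) * (1 + 2 ^ (1 / (q : ℝ))) *
        2 ^ (((min i w + 1 : ℕ) : ℝ) / (p : ℝ))) := by
    intro x y h
    have h3 := mul_le_mul_of_nonneg_left (key2 x y h) hα.le
    have h4 := mul_le_mul_of_nonneg_left h1q
      (by positivity : 0 ≤ α * ((2 : ℝ) ^ (((2 * m : ℕ) : ℝ) / (q : ℝ)) *
        2 ^ (((min i w + 1 : ℕ) : ℝ) / (p : ℝ))))
    linarith
  have hm0 : (0 : ℝ) ≤ m := Nat.cast_nonneg _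
  have hw0 : (0 : ℝ) ≤ w := Nat.cast_nonneg _
  have hmq : (2 * m + 2 : ℝ) ≤ q := by exact_mod_cast hm
  by_cases hbi : b < i
  · simp only [if_pos hbi]
    have hb' : ((b + 1 : ℕ) : ℝ) / p ≤ ((min i w + 1 : ℕ) : ℝ) / p := by
      gcongr
      exact le_min hbi.le hb
    split_ifs with h
    · rw [hsucc]
      apply fin1
      have : ((2 * j : ℕ) : ℝ) / q ≤ ((2 * m : ℕ) : ℝ) / q := by gcongr; omega
      linarith
    · apply fin2
      have : ((m + 1 + j : ℕ) : ℝ) / q ≤ 1 := by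
        rw [div_le_one hq0]; exact_mod_cast (by rw [if_pos hbi] at hj'; omega)
      have : (0 : ℝ) ≤ ((2 * m : ℕ) : ℝ) / q := by positivity
      linarith
  · simp only [if_neg hbi]
    rw [if_neg hbi] at hj'
    have hmin : min i w = i := by omega
    rw [hmin] at hp fin1 fin2 ⊢
    have hb' : ((b + 1 : ℕ) : ℝ) / p ≤ ((w + 1 : ℕ) : ℝ) / p := by
      gcongr
    have hi0 : (0 : ℝ) ≤ i := Nat.cast_nonneg _
    have hpe : (w : ℝ) * (q - m) ≤ p + i := by
      have := (Nat.cast_le (α := ℝ)).2 hp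
      rw [Nat.cast_mul, Nat.cast_sub (by omega), Nat.cast_add] at this
      exact this
    have hwq : (w : ℝ) * q ≤ 2 * (p + i) := by nlinarith
    split_ifs with h
    · rw [hsucc]
      apply fin1
      have h1 : ((2 * j : ℕ) : ℝ) / q ≤ ((2 * m : ℕ) : ℝ) / q - 2 / q := by
        rw [← sub_div]; gcongr
        have : (j : ℝ) + 1 ≤ m := by exact_mod_cast h
        push_cast; linarith
      have h2 : (w : ℝ) / p ≤ i / p + 2 / q := by
        have e : ((i : ℝ) / p + 2 / q) * p = (i * q + 2 * p) / q := by field_simp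
        rw [div_le_iff₀ hp0', e, le_div_iff₀ hq0]
        nlinarith [mul_nonneg hi0 (by linarith : (0 : ℝ) ≤ q - 2)]
      push_cast at h1 h2 hb' ⊢
      rw [add_div _ (1 : ℝ), add_div _ (1 : ℝ)] at *
      linarith
    · apply fin2
      have h1 : ((m + j : ℕ) : ℝ) / q ≤ 1 - 1 / q := by
        rw [le_sub_iff_add_le, ← add_div, div_le_one hq0]
        exact_mod_cast (by omega : m + j + 1 ≤ q)
      have h2 : (w : ℝ) / p ≤ i / p + ((2 * m : ℕ) : ℝ) / q + 1 / q := by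
        have h3 : (w : ℝ) * q ≤ p + i * q + 2 * m * p := by
          have h4 : (w : ℝ) ≤ p + i := by nlinarith
          nlinarith [mul_le_mul_of_nonneg_left h4 hm0]
        rw [div_le_iff₀ hp0']
        have : ((i : ℝ) / p + ((2 * m : ℕ) : ℝ) / q + 1 / q) * p = (p + i * q + 2 * m * p) / q := by
          push_cast; field_simp
          ring
        rw [this, le_div_iff₀ hq0]
        exact h3
      push_cast at h1 h2 hb' ⊢
      have e1 : ((w : ℝ) + 1) / p = w / p + 1 / p := add_div _ _ _
      have e2 : ((i : ℝ) + 1) / p = i / p + 1 / p := add_div _ _ _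
      linarith

theorem maxAvgRatio_le {X : List ℝ} {p : ℕ} (hlen : X.length = p) (hp : 0 < p) {M T B : ℝ}
    (hM : 0 ≤ M) (hmax : ∀ a ∈ X, a ≤ M) (hT : 0 < T) (hsum : T ≤ X.sum) (hB : 0 ≤ B)
    (h : p * M ≤ B * T) : maxAvgRatio X ≤ B := by
  have hp' : (0 : ℝ) < p := by exact_mod_cast hp
  rw [maxAvgRatio, listAvg, hlen, div_le_iff₀ (div_pos (hT.trans_le hsum) hp'), ← mul_div_assoc,
    le_div_iff₀ hp']
  have h1 := listMax_le hM hmax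
  calc listMax X * p ≤ M * p := by gcongr
    _ ≤ B * T := by linarith
    _ ≤ B * X.sum := by gcongr

theorem maxAvgRatio_le_length {X : List ℝ} (hX : ∀ a ∈ X, 0 < a) : maxAvgRatio X ≤ X.length := by
  have h0 : 0 ≤ X.sum := List.sum_nonneg fun a ha => (hX a ha).le
  have h1 : listMax X ≤ X.sum :=
    listMax_le h0 fun a ha => List.single_le_sum (fun b hb => (hX b hb).le) a ha
  rw [maxAvgRatio, listAvg, div_div_eq_mul_div]
  apply div_le_of_le_mul₀ h0 (by positivity)
  rw [mul_comm]
  gcongr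

/-- The balance between the largest weight and the total weight when the super-partitions consist
of many weights: `w` full super-partitions and a prefix of relative length `z`. -/
theorem balance_of_many {y z w E K : ℝ} (hy0 : 0 ≤ y) (hy : y ≤ 1 / 2) (hz0 : 0 ≤ z)
    (hz : z ≤ 1 - y) (hw : 1 ≤ w) (hE1 : 1 ≤ E) (hEy : E * (1 - y) ≤ 1.074)
    (hE : (y ≤ 1 / 4 ∧ E ≤ 1 + 1.66 * y) ∨ (1 / 4 ≤ y ∧ E ≤ 0.8283 + 2.344 * y))
    (hK : 1.673 ≤ K) :
    (w * (1 - y) + z) * (2.01 * E) ≤ w * 2.414 + K * (2 * min z y + E * (z - min z y)) := by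
  have hF : 0 ≤ 2 * min z y + E * (z - min z y) := by
    have : 0 ≤ min z y := le_min hz0 hy0
    have : min z y ≤ z := min_le_left _ _
    nlinarith
  have hKF := mul_le_mul_of_nonneg_right hK hF
  -- Each full super-partition beyond the first contributes nonnegative slack, as 2.01·1.074 <
  -- 2.414; this reduces the claim to w = 1.
  have hw' : (w - 1) * ((1 - y) * (2.01 * E)) ≤ (w - 1) * 2.414 := by
    apply mul_le_mul_of_nonneg_left _ (by linarith)
    linarith
  suffices h : (1 - y + z) * (2.01 * E) ≤
      2.414 + 1.673 * (2 * min z y + E * (z - min z y)) by linarith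
  have hE2 : E ≤ 1.0003 + 2 * y := by rcases hE with ⟨_, h⟩ | ⟨_, h⟩ <;> linarith
  rcases le_total z y with hzy | hzy
  · rw [min_eq_left hzy, sub_self, mul_zero, add_zero]
    rcases le_total (2.01 * E) 3.346 with h | h
    · have := mul_le_mul_of_nonneg_left h hz0
      linarith
    · have := mul_le_mul_of_nonneg_right hzy (sub_nonneg.2 h)
      linarith
  · rw [min_eq_right hzy]
    have h1 : (z - (1 - y)) * E ≤ 0 := mul_nonpos_of_nonpos_of_nonneg (by linarith) (by linarith)
    -- The difference of the two sides is monotone in z, so the worst case is z = 1 − y.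
    suffices h : E * (2.347 - 0.674 * y) ≤ 2.414 + 3.346 * y by nlinarith
    have h2 : 0 ≤ 2.347 - 0.674 * y := by linarith
    rcases hE with ⟨h3, h⟩ | ⟨h3, h⟩
    · have := mul_le_mul_of_nonneg_right h h2
      nlinarith
    · have := mul_le_mul_of_nonneg_right h h2
      nlinarith [sq_nonneg (y - 0.505)]

theorem full_parts_le {p q m w n i : ℕ} (hm : 2 * m + 2 ≤ q)
    (hp : p + min i w = w * (q - m) + n) : w * q ≤ 2 * p := by
  have h1 : q - m = (q - m - 1) + 1 := by omega
  have h2 : w * (q - m) = w * (q - m - 1) + w := by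
    conv_lhs => rw [h1, Nat.mul_succ]
  have h3 : w * q ≤ w * (2 * (q - m - 1)) := Nat.mul_le_mul_left _ (by omega)
  have h4 : w * (2 * (q - m - 1)) = 2 * (w * (q - m - 1)) := by ring
  have := min_le_right i w
  omega

/-- Here w may be as small as 1, so the partial super-partition must be counted, but the differing
bases may be ignored. After division by q the claim becomes `balance_of_many` with y = m/q and z =
n/q. No 1/p error is needed. -/
theorem weightBound_le_of_many {p q m w n i : ℕ} (hq : 1024 ≤ q) (hqp : q ≤ p)
    (hm : 2 * m + 2 ≤ q) (hw : 1 ≤ w) (hn : n ≤ q - m)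
    (hp : p + min i w = w * (q - m) + n) :
    p * weightBound p q m (min i w) ≤ limitRatio *
      (2 ^ (1 / (p : ℝ)) * (w * (2 ^ (1 / (q : ℝ)) - 1)⁻¹ +
      (2 * (min n m : ℕ) + 2 ^ (((2 * m : ℕ) : ℝ) / (q : ℝ)) * (n - min n m : ℕ)))) := by
  have hq0 : (0 : ℝ) < q := by exact_mod_cast (by omega : 0 < q)
  have hp0 : (0 : ℝ) < p := by exact_mod_cast (by omega : 0 < p)
  have hw0 : (1 : ℝ) ≤ w := by exact_mod_cast hw
  have hm0 : (0 : ℝ) ≤ m := Nat.cast_nonneg _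
  have hn0 : (0 : ℝ) ≤ n := Nat.cast_nonneg _
  have hq' : (1024 : ℝ) ≤ q := by exact_mod_cast hq
  have hmq : (2 * m + 2 : ℝ) ≤ q := by exact_mod_cast hm
  have hn' : (n : ℝ) ≤ q - m := by
    rw [← Nat.cast_sub (by omega)]; exact_mod_cast hn
  have hwq : (w : ℝ) * q ≤ 2 * p := by exact_mod_cast full_parts_le hm hp
  have hpe : (p : ℝ) ≤ w * (q - m) + n := by
    have h : p ≤ w * (q - m) + n := by omega
    have h2 := (Nat.cast_le (α := ℝ)).2 h
    rw [Nat.cast_add, Nat.cast_mul, Nat.cast_sub (by omega)] at h2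
    exact h2
  set P : ℝ := 2 ^ (1 / (p : ℝ)) with hP
  set g : ℝ := 2 ^ (1 / (q : ℝ)) with hg
  have hP0 : 0 < P := by positivity
  have hg0 : 0 < g := by positivity
  have hg1 : 1 < g := Real.one_lt_rpow one_lt_two (by positivity)
  have hE : (2 : ℝ) ^ (((2 * m : ℕ) : ℝ) / (q : ℝ)) = 2 ^ (2 * ((m : ℝ) / q)) := by
    congr 1; push_cast; ring
  have hy0 : (0 : ℝ) ≤ m / q := by positivity
  have hy1 : (m : ℝ) / q ≤ 1 / 2 := by rw [div_le_div_iff₀ hq0 two_pos]; linarith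
  have hEy := two_rpow_two_mul_mul_le hy0 hy1
  have hchord := two_rpow_two_mul_le hy0 hy1
  have hE1 : (1 : ℝ) ≤ 2 ^ (2 * ((m : ℝ) / q)) := Real.one_le_rpow one_le_two (by positivity)
  rw [weightBound, hE]
  set E : ℝ := 2 ^ (2 * ((m : ℝ) / q))
  have hi : (2 : ℝ) ^ (((min i w + 1 : ℕ) : ℝ) / (p : ℝ)) ≤ P * g ^ 2 := by
    rw [hP, hg, ← Real.rpow_natCast, ← Real.rpow_mul zero_le_two, ← Real.rpow_add two_pos]
    apply Real.rpow_le_rpow_of_exponent_le one_le_two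
    have h1 : ((min i w : ℕ) : ℝ) ≤ w := by exact_mod_cast min_le_right i w
    have h2 : ((min i w : ℕ) : ℝ) / p ≤ 2 / q := by
      rw [div_le_div_iff₀ hp0 hq0]
      nlinarith
    have e : ((min i w + 1 : ℕ) : ℝ) / (p : ℝ) = ((min i w : ℕ) : ℝ) / p + 1 / p := by
      push_cast; ring
    rw [e]
    push_cast at h2 ⊢
    have e2 : 1 / (q : ℝ) * 2 = 2 / q := by ring
    linarith
  have hinv : (q : ℝ) / Real.log 2 ≤ g * (g - 1)⁻¹ := by
    have h := two_rpow_sub_one_le (1 / (q : ℝ))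
    rw [← hg] at h
    rw [div_le_iff₀ log_two_pos, ← div_eq_mul_inv, div_mul_eq_mul_div, le_div_iff₀ (by linarith)]
    calc (q : ℝ) * (g - 1) ≤ q * (Real.log 2 * (1 / q) * g) := by gcongr
      _ = g * Real.log 2 := by field_simp
  have hg4 : g ^ 4 ≤ 1.004 := by
    have e : g ^ 4 = 2 ^ (4 / (q : ℝ)) := by
      rw [hg, ← Real.rpow_natCast, ← Real.rpow_mul zero_le_two]; congr 1; push_cast; ring
    rw [e]
    refine (two_rpow_le_one_add (by positivity) ?_).trans ?_
    · rw [div_le_one hq0]; linarith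
    · have : 4 / (q : ℝ) ≤ 4 / 1024 := by gcongr
      norm_num at this ⊢
      linarith
  have hcastmin : ((min n m : ℕ) : ℝ) = q * min ((n : ℝ) / q) (m / q) := by
    rw [min_div_div_right hq0.le, mul_div_cancel₀ _ hq0.ne', Nat.cast_min]
  have hcastsub : ((n - min n m : ℕ) : ℝ) = q * (n / q - min ((n : ℝ) / q) (m / q)) := by
    rw [Nat.cast_sub (min_le_left _ _), hcastmin, mul_sub, mul_div_cancel₀ _ hq0.ne']
  have hbal := balance_of_many hy0 hy1 (by positivity : 0 ≤ (n : ℝ) / q)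
    (by rw [div_le_iff₀ hq0, sub_mul, div_mul_cancel₀ _ hq0.ne']; linarith) hw0 hE1 hEy hchord
    (by linarith [limitRatio_bounds.1] : 1.673 ≤ limitRatio)
  set F := 2 * min ((n : ℝ) / q) (m / q) + E * (n / q - min ((n : ℝ) / q) (m / q)) with hF
  have hFe : 2 * ((min n m : ℕ) : ℝ) + E * ((n - min n m : ℕ) : ℝ) = q * F := by
    rw [hcastmin, hcastsub, hF]; ring
  rw [hFe]
  have hF0 : 0 ≤ F := by
    have h1 : min ((n : ℝ) / q) (m / q) ≤ n / q := min_le_left _ _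
    have h2 : 0 ≤ min ((n : ℝ) / q) (m / q) := le_min (by positivity) (by positivity)
    have := mul_nonneg (by linarith : 0 ≤ E) (sub_nonneg.2 h1)
    linarith
  have hK : 2.414 ≤ limitRatio / Real.log 2 := by
    rw [limitRatio_eq, mul_div_cancel_left₀ _ log_two_pos.ne']
    linarith [sqrt_two_bounds.1]
  have hK0 : 0 < limitRatio := by linarith [limitRatio_bounds.1]
  have hmain : (p : ℝ) * (2.01 * E) ≤ limitRatio * (g * (w * (g - 1)⁻¹ + q * F)) := by
    calc (p : ℝ) * (2.01 * E) ≤ (w * (q - m) + n) * (2.01 * E) := by gcongr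
      _ = q * ((w * (1 - m / q) + n / q) * (2.01 * E)) := by field_simp
      _ ≤ q * (w * 2.414 + limitRatio * F) := by gcongr
      _ ≤ q * (w * (limitRatio / Real.log 2) + limitRatio * F) := by gcongr
      _ = limitRatio * (w * (q / Real.log 2) + q * F) := by ring
      _ ≤ limitRatio * (w * (g * (g - 1)⁻¹) + g * (q * F)) := by
          have h1 : q * F ≤ g * (q * F) := le_mul_of_one_le_left (by positivity) hg1.le
          have h2 := mul_le_mul_of_nonneg_left hinv (by linarith : (0 : ℝ) ≤ w)
          exact mul_le_mul_of_nonneg_left (add_le_add h2 h1) hK0.le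
      _ = _ := by ring
  -- All powers of g that were lost are collected here: two from the base min i w + 1, one from
  -- replacing 1/(g − 1) by q/ln 2.
  have hg3 : (1 + g) * g ^ 3 ≤ 2.01 := by
    have h1 : (1 + g) * g ^ 3 ≤ (g + g) * g ^ 3 := by gcongr
    have e : (g + g) * g ^ 3 = 2 * g ^ 4 := by ring
    linarith
  have hfin : g * (p * (E * (1 + g) * 2 ^ (((min i w + 1 : ℕ) : ℝ) / (p : ℝ)))) ≤
      g * (limitRatio * (P * (w * (g - 1)⁻¹ + q * F))) := by
    calc g * (p * (E * (1 + g) * 2 ^ (((min i w + 1 : ℕ) : ℝ) / (p : ℝ))))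
        ≤ g * (p * (E * (1 + g) * (P * g ^ 2))) := by gcongr
      _ = p * E * P * ((1 + g) * g ^ 3) := by ring
      _ ≤ p * E * P * 2.01 := by gcongr
      _ = P * (p * (2.01 * E)) := by ring
      _ ≤ P * (limitRatio * (g * (w * (g - 1)⁻¹ + q * F))) := by gcongr
      _ = _ := by ring
  exact le_of_mul_le_mul_left hfin hg0

/-- The left side is p times the integral of 2^x over [0, w/p], and the right side is its upper
Riemann sum. -/
theorem sum_two_rpow_ge {p : ℕ} (hp : 0 < p) (w : ℕ) :
    p * (2 ^ ((w : ℝ) / p) - 1) / Real.log 2 ≤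
      ∑ b ∈ Finset.range w, (2 : ℝ) ^ (((b + 1 : ℕ) : ℝ) / (p : ℝ)) := by
  have hp0 : (0 : ℝ) < p := by exact_mod_cast hp
  set P : ℝ := 2 ^ (1 / (p : ℝ)) with hP
  have hP1 : 1 < P := Real.one_lt_rpow one_lt_two (by positivity)
  have hk : ∀ k : ℕ, (2 : ℝ) ^ ((k : ℝ) / (p : ℝ)) = P ^ k := by
    intro k
    rw [hP, ← Real.rpow_natCast, ← Real.rpow_mul zero_le_two]
    congr 1; ring
  simp only [hk, pow_succ]
  rw [← Finset.sum_mul, geom_sum_eq hP1.ne', div_mul_eq_mul_div,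
    div_le_div_iff₀ log_two_pos (by linarith)]
  have h := two_rpow_sub_one_le (1 / (p : ℝ))
  rw [← hP] at h
  have h1 : (p : ℝ) * (P - 1) ≤ Real.log 2 * P := by
    calc (p : ℝ) * (P - 1) ≤ p * (Real.log 2 * (1 / p) * P) := by gcongr
      _ = _ := by field_simp
  have h2 : 0 ≤ P ^ w - 1 := by linarith [one_le_pow₀ hP1.le (n := w)]
  nlinarith [mul_le_mul_of_nonneg_left h1 h2]

/-- With r = 1/p this absorbs all rounding errors: D stays away from 0 because q ≤ 1024, so a large
multiple of r added to K outweighs the relative error O(r/D). -/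
theorem mul_one_add_le_of_error {K D r : ℝ} (hK0 : 0 ≤ K) (hK : K ≤ 1.6735) (hD0 : 1 / 2048 ≤ D)
    (hD1 : D ≤ 1) (hr0 : 0 ≤ r) (hr1 : r ≤ 1 / 16384) :
    K * D * (1 + r) ≤ (K + 16384 ^ 2 * r) * (D - 2 * r) := by
  have h1 : K * D ≤ K := mul_le_of_le_one_right hK0 hD1
  have h2 : 1 / 4096 ≤ D - 2 * r := by linarith
  have h3 : 0 ≤ r * (16384 ^ 2 * (D - 2 * r) - K * D - 2 * K) := by
    apply mul_nonneg hr0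
    linarith
  linarith

set_option maxHeartbeats 1000000 in
-- Here w is large, so the partial super-partition may be dropped from the total, but the growth of
-- the bases matters. With β = min i w / p and c = 1/(q − m), the total is governed by D =
-- 2^((1+β)c) − 1, and `ratio_decreases` followed by `round_ratio_le` gives the constant.
theorem weightBound_le_of_few {p q m w n i : ℕ} (hq : q = 2 ∨ q = 4 ∨ 8 ≤ q) (hq' : q ≤ 1024)
    (hp1 : 16384 ≤ p) (hm : 2 * m + 2 ≤ q) (hn : n ≤ q - m)
    (hp : p + min i w = w * (q - m) + n) :
    p * weightBound p q m (min i w) ≤ (limitRatio + 16384 ^ 2 / p) *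
      ((∑ b ∈ Finset.range w, 2 ^ (((b + 1 : ℕ) : ℝ) / (p : ℝ))) *
        (2 ^ (1 / (q : ℝ)) - 1)⁻¹) := by
  have hq0 : (0 : ℝ) < q := by exact_mod_cast (by omega : 0 < q)
  have hp1' : (16384 : ℝ) ≤ p := by exact_mod_cast hp1
  have hp0 : (0 : ℝ) < p := by linarith
  have hmq : (2 * m + 2 : ℝ) ≤ q := by exact_mod_cast hm
  have hm0 : (0 : ℝ) ≤ m := Nat.cast_nonneg _
  have hqm : (2 : ℝ) ≤ q - m := by
    have : 2 ≤ q - m := by omega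
    rw [← Nat.cast_sub (by omega)]; exact_mod_cast this
  have hq1 : (q : ℝ) ≤ 1024 := by exact_mod_cast hq'
  have hwp : w ≤ p := by
    have := full_parts_le hm hp
    have : w * 2 ≤ w * q := Nat.mul_le_mul_left _ (by omega)
    omega
  have hpe : (p : ℝ) + (min i w : ℕ) ≤ (w + 1) * (q - m) := by
    have h : p + min i w ≤ (w + 1) * (q - m) := by rw [Nat.succ_mul]; omega
    have h2 := (Nat.cast_le (α := ℝ)).2 h
    rw [Nat.cast_add, Nat.cast_mul, Nat.cast_sub (by omega), Nat.cast_add w 1, Nat.cast_one] at h2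
    exact h2
  set β : ℝ := ((min i w : ℕ) : ℝ) / p with hβ
  have hβ0 : 0 ≤ β := by positivity
  have hβ1 : β ≤ 1 := by
    rw [hβ, div_le_one hp0]; exact_mod_cast (min_le_right i w).trans hwp
  set c : ℝ := 1 / ((q : ℝ) - m) with hc
  have hc0 : 0 ≤ c := by positivity
  have hc2 : c ≤ 1 / 2 := by rw [hc]; gcongr
  have hc3 : 1 / 1024 ≤ c := by
    rw [hc]
    apply one_div_le_one_div_of_le (by linarith)
    linarith
  -- The dropped partial super-partition counts as at most one whole one, which costs 1/p in w/p.
  have hwc : (1 + β) * c - 1 / p ≤ w / p := by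
    have : (p : ℝ) * (1 + β) ≤ (w + 1) * (q - m) := by
      rw [hβ, mul_add, mul_one, mul_div_cancel₀ _ hp0.ne']; exact hpe
    have h2 : (p : ℝ) * (1 + β) * c ≤ w + 1 := by
      rw [hc, mul_one_div, div_le_iff₀ (by linarith)]; exact this
    rw [sub_le_iff_le_add, ← add_div, le_div_iff₀ hp0]
    linarith
  set g : ℝ := 2 ^ (1 / (q : ℝ)) with hg
  have hg1 : 1 < g := Real.one_lt_rpow one_lt_two (by positivity)
  set D : ℝ := 2 ^ ((1 + β) * c) - 1 with hD
  have hround := round_ratio_le hm hq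
  have hdec := ratio_decreases hc0 hβ0 hβ1
  rw [← hc] at hround
  rw [← hD] at hdec
  have hg2 : (2 : ℝ) ^ (2 / (q : ℝ)) = g ^ 2 := by
    rw [hg, ← Real.rpow_natCast, ← Real.rpow_mul zero_le_two]; congr 1; push_cast; ring
  rw [hg2] at hround
  set E : ℝ := 2 ^ (((2 * m : ℕ) : ℝ) / (q : ℝ))
  have hE0 : 0 < E := by positivity
  have hs := sqrt_two_bounds
  have hpow : (2 : ℝ) ^ (((min i w + 1 : ℕ) : ℝ) / (p : ℝ)) = 2 ^ β * 2 ^ (1 / (p : ℝ)) := by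
    rw [← Real.rpow_add two_pos, hβ]; congr 1; push_cast; ring
  have hP : (2 : ℝ) ^ (1 / (p : ℝ)) ≤ 1 + 1 / p :=
    two_rpow_le_one_add (by positivity) (by rw [div_le_one hp0]; linarith)
  have hD1 : D ≤ 1 := by
    have h := two_rpow_le_one_add (x := (1 + β) * c) (by positivity) (by nlinarith)
    rw [hD]
    nlinarith
  have hD0 : 1 / 2048 ≤ D := by
    have h := one_add_log_two_mul_le ((1 + β) * c)
    have h2 : (1 / 2) * ((1 + β) * c) ≤ Real.log 2 * ((1 + β) * c) := by
      gcongr; linarith [Real.log_two_gt_d9]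
    rw [hD]
    nlinarith
  have hD' : D - 2 / p ≤ 2 ^ ((w : ℝ) / p) - 1 := by
    have h1 : (2 : ℝ) ^ ((1 + β) * c - 1 / p) ≤ 2 ^ ((w : ℝ) / p) :=
      Real.rpow_le_rpow_of_exponent_le one_le_two hwc
    have h2 : (2 : ℝ) ^ ((1 + β) * c - 1 / p) = (D + 1) * 2 ^ (-(1 / (p : ℝ))) := by
      rw [hD, sub_add_cancel, ← Real.rpow_add two_pos]; rfl
    have h3 := one_add_log_two_mul_le (-(1 / (p : ℝ)))
    have h4 : Real.log 2 * (1 / p) ≤ 1 * (1 / p) := by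
      gcongr; linarith [Real.log_two_lt_d9]
    have h5 : (D + 1) * (1 - 1 / p) ≤ (D + 1) * 2 ^ (-(1 / (p : ℝ))) := by
      gcongr
      linarith
    have h6 : (D + 1) * (1 / p) ≤ 2 * (1 / p) := by gcongr; linarith
    have e : 2 / (p : ℝ) = 2 * (1 / p) := by ring
    rw [e]
    linarith
  have hsum := sum_two_rpow_ge (by omega : 0 < p) w
  rw [weightBound, hpow, ← div_eq_mul_inv, ← mul_div_assoc, le_div_iff₀ (by linarith)]
  have hK := limitRatio_bounds
  have hB0 : 0 ≤ limitRatio + 16384 ^ 2 / p := by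
    have : (0 : ℝ) ≤ 16384 ^ 2 / p := by positivity
    linarith
  have hkey : Real.log 2 * (E * (g ^ 2 - 1)) * 2 ^ β ≤ limitRatio * D := by
    have h1 : E * (g ^ 2 - 1) ≤ (√2 + 1) * (2 ^ c - 1) := by
      have h2 : √2 ^ 2 = 2 := Real.sq_sqrt zero_le_two
      have h3 := mul_le_mul_of_nonneg_left hround (by linarith : 0 ≤ √2 + 1)
      have e : (√2 + 1) * ((√2 - 1) * (E * (g ^ 2 - 1))) = (√2 ^ 2 - 1) * (E * (g ^ 2 - 1)) := by
        ring
      rw [e, h2] at h3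
      linarith
    calc Real.log 2 * (E * (g ^ 2 - 1)) * 2 ^ β
        ≤ Real.log 2 * ((√2 + 1) * (2 ^ c - 1)) * 2 ^ β := by
          have := log_two_pos.le
          gcongr
      _ = limitRatio * (2 ^ β * (2 ^ c - 1)) := by rw [limitRatio_eq]; ring
      _ ≤ _ := by gcongr; linarith
  have hcomb : limitRatio * D * (1 + 1 / p) ≤
      (limitRatio + 16384 ^ 2 / p) * (D - 2 / p) := by
    have e1 : (16384 : ℝ) ^ 2 / p = 16384 ^ 2 * (1 / p) := by ring
    have e2 : (2 : ℝ) / p = 2 * (1 / p) := by ring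
    rw [e1, e2]
    exact mul_one_add_le_of_error (by linarith) hK.2.le hD0 hD1 (by positivity)
      (one_div_le_one_div_of_le (by norm_num) hp1')
  have hchain : Real.log 2 * (p * (E * (1 + g) * (2 ^ β * 2 ^ (1 / (p : ℝ)))) * (g - 1)) ≤
      Real.log 2 * ((limitRatio + 16384 ^ 2 / p) *
        ∑ b ∈ Finset.range w, 2 ^ (((b + 1 : ℕ) : ℝ) / (p : ℝ))) := by
    have hKD : 0 ≤ limitRatio * D := by nlinarith
    calc Real.log 2 * (p * (E * (1 + g) * (2 ^ β * 2 ^ (1 / (p : ℝ)))) * (g - 1))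
        = p * ((Real.log 2 * (E * (g ^ 2 - 1)) * 2 ^ β) * 2 ^ (1 / (p : ℝ))) := by ring
      _ ≤ p * (limitRatio * D * (1 + 1 / p)) := by gcongr
      _ ≤ p * ((limitRatio + 16384 ^ 2 / p) * (D - 2 / p)) := by gcongr
      _ ≤ p * ((limitRatio + 16384 ^ 2 / p) * (2 ^ ((w : ℝ) / p) - 1)) := by gcongr
      _ = Real.log 2 * ((limitRatio + 16384 ^ 2 / p) *
          (p * (2 ^ ((w : ℝ) / p) - 1) / Real.log 2)) := by
          have := log_two_pos.ne'
          field_simp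
      _ ≤ _ := by
          have := log_two_pos.le
          gcongr
  exact le_of_mul_le_mul_left hchain log_two_pos

/-- The max-over-average ratio during a round of the scheme. -/
theorem maxAvgRatio_take_le {p : ℕ} {α : ℝ} (hα : 0 < α) {q m i : ℕ}
    (hq : q = 2 ∨ q = 4 ∨ 8 ≤ q) (hqp : q ≤ p) (hm : 2 * m + 2 ≤ q)
    (hlen : p ≤ (schemeParts p α q m i).flatten.length) :
    maxAvgRatio ((schemeParts p α q m i).flatten.take p) ≤ limitRatio + 16384 ^ 2 / p := by
  have hp0 : 0 < p := by omega
  have hp0' : (0 : ℝ) < p := by exact_mod_cast hp0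
  have hK := limitRatio_bounds
  -- For p < 16384 the trivial bound p on the ratio is already below 16384²/p.
  by_cases hsmall : q ≤ 1024 ∧ p < 16384
  · have hl : ((schemeParts p α q m i).flatten.take p).length = p := by
      rw [List.length_take]; omega
    have hpos : ∀ a ∈ (schemeParts p α q m i).flatten.take p, 0 < a := by
      intro a ha
      obtain ⟨l, hl, hal⟩ := List.mem_flatten.1 (List.mem_of_mem_take ha)
      simp only [schemeParts, List.mem_map] at hl
      obtain ⟨b, -, rfl⟩ := hl
      exact pos_of_mem_schemePart hα a hal
    have h1 := maxAvgRatio_le_length hpos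
    rw [hl] at h1
    have h2 : (p : ℝ) ≤ 16384 := by exact_mod_cast hsmall.2.le
    have h3 : (p : ℝ) ≤ 16384 ^ 2 / p := by
      rw [le_div_iff₀ hp0']; nlinarith
    linarith
  have hB0 : (0 : ℝ) ≤ 16384 ^ 2 / p := by positivity
  have hflat : ((List.range (p + 1)).map (schemePart p α q m i)).flatten =
      (schemeParts p α q m i).flatten ++ schemePart p α q m i p := by
    simp [schemeParts, List.range_succ]
  have hlenp : 0 < (schemePart p α q m i p).length := by
    rw [length_schemePart]; split_ifs <;> omega
  -- A fictitious super-partition is appended, so that position p exists even when the concatenation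
  -- has exactly p entries, as at the end of the last round.
  obtain ⟨w, n, hw, hn, hp, htake, -⟩ := exists_take_flatten (schemePart p α q m i) (p + 1) p
    (by rw [hflat, List.length_append]; omega)
  rw [hflat, List.take_append_of_le_length hlen] at htake
  have hlw := length_flatten_schemePart p α (show m + 1 ≤ q by omega) i w
  have hn' := hn
  rw [length_schemePart] at hn'
  have hn2 : n < q - m := by split_ifs at hn' <;> omega
  have hpe : p + min i w = w * (q - m) + n := by omega
  have hw1 : 1 ≤ w := by
    by_contra! h
    obtain rfl : w = 0 := by omega
    omega
  have hlX : ((schemeParts p α q m i).flatten.take p).length = p := by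
      rw [List.length_take]; omega
  have hmax : ∀ a ∈ (schemeParts p α q m i).flatten.take p,
      a ≤ α * weightBound p q m (min i w) := by
    intro a ha
    rw [htake, List.mem_append] at ha
    have hle : w * (q - m) ≤ p + min i w := by omega
    rcases ha with h | h
    · obtain ⟨l, hl, hal⟩ := List.mem_flatten.1 h
      obtain ⟨b, hb, rfl⟩ := List.mem_map.1 hl
      exact le_of_mem_schemePart hα hm hp0 hle (List.mem_range.1 hb).le a hal
    · exact le_of_mem_schemePart hα hm hp0 hle le_rfl a (List.mem_of_mem_take h)
  have hM0 : 0 ≤ α * weightBound p q m (min i w) :=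
    mul_nonneg hα.le (weightBound_pos ..).le
  have hw0 : (1 : ℝ) ≤ w := by exact_mod_cast hw1
  have hq1 : (1 : ℝ) < 2 ^ (1 / (q : ℝ)) := Real.one_lt_rpow one_lt_two (by
    have : (0 : ℝ) < q := by exact_mod_cast (by omega : 0 < q)
    positivity)
  have hinv : 0 < ((2 : ℝ) ^ (1 / (q : ℝ)) - 1)⁻¹ := inv_pos.2 (by linarith)
  have hEn : 0 ≤ 2 * ((min n m : ℕ) : ℝ) +
      2 ^ (((2 * m : ℕ) : ℝ) / (q : ℝ)) * ((n - min n m : ℕ) : ℝ) := by positivity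
  by_cases hbig : q ≤ 1024
  · have h := weightBound_le_of_few hq hbig (by omega : 16384 ≤ p) hm hn2.le hpe
    have hge := sum_schemePrefix_ge hα hm hn.le
    have hS : 0 < ∑ b ∈ Finset.range w, (2 : ℝ) ^ (((b + 1 : ℕ) : ℝ) / (p : ℝ)) :=
      Finset.sum_pos (fun b _ => by positivity) (by simp; omega)
    refine maxAvgRatio_le hlX hp0 hM0 hmax (mul_pos hα (mul_pos hS hinv)) ?_ (by linarith) ?_
    · rw [htake]
      refine le_trans ?_ hge
      gcongr
      exact le_add_of_nonneg_right (by positivity)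
    · have := mul_le_mul_of_nonneg_left h hα.le
      linarith
  · have h := weightBound_le_of_many (by omega : 1024 ≤ q) hqp hm hw1 hn2.le hpe
    have hge := sum_schemePrefix_ge' hα hm hn.le
    refine maxAvgRatio_le hlX hp0 hM0 hmax (T := α * (2 ^ (1 / (p : ℝ)) *
      (w * (2 ^ (1 / (q : ℝ)) - 1)⁻¹ + (2 * ((min n m : ℕ) : ℝ) +
      2 ^ (((2 * m : ℕ) : ℝ) / (q : ℝ)) * ((n - min n m : ℕ) : ℝ))))) ?_ ?_ (by linarith) ?_
    · have : 0 < (w : ℝ) * (2 ^ (1 / (q : ℝ)) - 1)⁻¹ := mul_pos (by linarith) hinv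
      exact mul_pos hα (mul_pos (by positivity) (by linarith))
    · rw [htake]; exact hge
    · have h2 := mul_le_mul_of_nonneg_left h hα.le
      have hT : 0 ≤ α * (2 ^ (1 / (p : ℝ)) *
        (w * (2 ^ (1 / (q : ℝ)) - 1)⁻¹ + (2 * ((min n m : ℕ) : ℝ) +
        2 ^ (((2 * m : ℕ) : ℝ) / (q : ℝ)) * ((n - min n m : ℕ) : ℝ)))) := by positivity
      have h3 := mul_nonneg hB0 hT
      linarith

/-! ## The configurations of the periodic scheme -/

/-- `Y` is obtained from the configuration `X` of `p` parts when a weight `e`, at most four times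
the average, arrives and two neighbours are merged. -/
def FlowStep (p : ℕ) (X Y : List ℝ) : Prop :=
  ∃ (g : ℕ) (e : ℝ), g < p ∧ 0 < e ∧ p * e ≤ 4 * X.sum ∧ Y = mergeAt (X ++ [e]) g

theorem FlowStep.sum_eq {p : ℕ} {X Y : List ℝ} (h : FlowStep p X Y) (hX : X.length = p) :
    ∃ e, 0 < e ∧ p * e ≤ 4 * X.sum ∧ Y.sum = X.sum + e := by
  obtain ⟨g, e, hg, he, hle, rfl⟩ := h
  refine ⟨e, he, hle, ?_⟩
  rw [sum_mergeAt (by simp; omega)]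
  simp

theorem FlowStep.sum_take {p : ℕ} {X Y : List ℝ} (h : FlowStep p X Y) (hX : X.length = p)
    {i : ℕ} (hi1 : 1 ≤ i) (hi : i < p) :
    ∃ i', 1 ≤ i' ∧ i' ≤ p ∧ (Y.take i).sum = (X.take i').sum := by
  obtain ⟨g, e, hg, he, hle, rfl⟩ := h
  refine ⟨if i ≤ g then i else i + 1, by split_ifs <;> omega, by split_ifs <;> omega, ?_⟩
  rw [sum_take_mergeAt (by simp; omega) (by simp; omega),
    List.take_append_of_le_length (by split_ifs <;> omega)]

/-- What is known about the configurations recorded so far; the last one is `X`. -/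
structure ConfigsInv (p : ℕ) (B : ℝ) (X : List ℝ) (cs : List (List ℝ)) : Prop where
  last : cs.getLast? = some X
  head : cs.head? = some (superPartition p 2 1)
  chain : cs.IsChain (FlowStep p)
  length_eq : ∀ Y ∈ cs, Y.length = p
  pos : ∀ Y ∈ cs, ∀ a ∈ Y, 0 < a
  ratio_le : ∀ Y ∈ cs, maxAvgRatio Y ≤ B

theorem ConfigsInv.append {p : ℕ} {B : ℝ} {X Y : List ℝ} {cs : List (List ℝ)}
    (h : ConfigsInv p B X cs) (hstep : FlowStep p X Y) (hlen : Y.length = p)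
    (hpos : ∀ a ∈ Y, 0 < a) (hratio : maxAvgRatio Y ≤ B) : ConfigsInv p B Y (cs ++ [Y]) where
  last := by simp
  head := by rw [List.head?_append, h.head]; rfl
  chain := by
    rw [List.isChain_append]
    refine ⟨h.chain, by simp, ?_⟩
    intro x hx y hy
    rw [h.last] at hx
    simp only [Option.mem_def, Option.some.injEq, List.head?_cons] at hx hy
    rw [← hx, ← hy]
    exact hstep
  length_eq := by
    intro Z hZ
    rcases List.mem_append.1 hZ with hZ | hZ
    · exact h.length_eq Z hZ
    · rw [List.mem_singleton.1 hZ]; exact hlen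
  pos := by
    intro Z hZ
    rcases List.mem_append.1 hZ with hZ | hZ
    · exact h.pos Z hZ
    · rw [List.mem_singleton.1 hZ]; exact hpos
  ratio_le := by
    intro Z hZ
    rcases List.mem_append.1 hZ with hZ | hZ
    · exact h.ratio_le Z hZ
    · rw [List.mem_singleton.1 hZ]; exact hratio

theorem length_flatten_schemeParts (p : ℕ) (α : ℝ) {q m i : ℕ} (hm : 2 * m + 2 ≤ q)
    (hi : i ≤ p) : p + (p - i) ≤ (schemeParts p α q m i).flatten.length := by
  have h := length_flatten_schemePart p α (show m + 1 ≤ q by omega) i p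
  rw [min_eq_left hi] at h
  have h2 : p * 2 ≤ p * (q - m) := Nat.mul_le_mul_left _ (by omega)
  unfold schemeParts
  omega

theorem pos_of_mem_flatten_schemeParts {p : ℕ} {α : ℝ} (hα : 0 < α) (q m i : ℕ) :
    ∀ a ∈ (schemeParts p α q m i).flatten, 0 < a := by
  intro a ha
  obtain ⟨l, hl, hal⟩ := List.mem_flatten.1 ha
  simp only [schemeParts, List.mem_map] at hl
  obtain ⟨b, -, rfl⟩ := hl
  exact pos_of_mem_schemePart hα a hal

/-- The bound for the max-over-average ratio. -/
def ratioBound (p : ℕ) : ℝ := limitRatio + 16384 ^ 2 / p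

theorem configsInv_schemeStep {p : ℕ} {α : ℝ} (hα : 0 < α) {q m i : ℕ}
    (hq : q = 2 ∨ q = 4 ∨ 8 ≤ q) (hqp : q ≤ p) (hm : 2 * m + 2 ≤ q) (hi : i < p)
    {st : SchemeState} (hst : st.parts = schemeParts p α q m i)
    (h : ConfigsInv p (ratioBound p) ((schemeParts p α q m i).flatten.take p) st.configs) :
    (schemeStep p st i).parts = schemeParts p α q m (i + 1) ∧
      ConfigsInv p (ratioBound p) ((schemeParts p α q m (i + 1)).flatten.take p)
        (schemeStep p st i).configs := by
  have hparts : st.parts.modify i mergeNext = schemeParts p α q m (i + 1) := by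
    rw [hst, schemeParts_modify hα hm]
  refine ⟨hparts, ?_⟩
  simp only [schemeStep, hparts]
  have hlen := length_flatten_schemeParts p α hm hi.le
  have hlen' := length_flatten_schemeParts p α hm (show i + 1 ≤ p from hi)
  have hpos := pos_of_mem_flatten_schemeParts (p := p) hα q m i
  have hpos' := pos_of_mem_flatten_schemeParts (p := p) hα q m (i + 1)
  have hratio := maxAvgRatio_take_le hα (i := i + 1) hq hqp hm (by omega)
  have hnext := next_weight_le (p := p) hα (i := i) hm (by omega)
  have hglt : (((List.range i).map (schemePart p α q m i)).flatten).length + m + 1 <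
      (schemeParts p α q m i).flatten.length := by
    have h1 := length_flatten_schemePart p α (show m + 1 ≤ q by omega) i p
    have h2 := length_flatten_schemePart p α (show m + 1 ≤ q by omega) i i
    rw [min_eq_left hi.le] at h1
    rw [min_self] at h2
    have h3 : (i + 1) * (q - m) ≤ p * (q - m) := Nat.mul_le_mul_right _ hi
    rw [Nat.succ_mul] at h3
    unfold schemeParts
    omega
  have hflat := flatten_schemeParts_succ hα hm hi
  rw [hflat] at hpos' hratio hlen' ⊢
  set A := (schemeParts p α q m i).flatten
  set g := (((List.range i).map (schemePart p α q m i)).flatten).length + m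
  by_cases hg : g < p
  · have htake : (mergeAt A g).take p = mergeAt (A.take p ++ [A[p]]) g := by
      rw [take_mergeAt_of_lt hg (by omega), List.take_concat_get' A p (by omega)]
    have hstep : FlowStep p (A.take p) ((mergeAt A g).take p) :=
      ⟨g, A[p], hg, hpos _ (List.getElem_mem _), hnext hg, htake⟩
    -- The total has grown by the entering weight, so the new configuration is really recorded.
    have hne : ¬ st.configs.getLast? = some ((mergeAt A g).take p) := by
      rw [h.last, Option.some.injEq]
      intro heq
      obtain ⟨e, he, -, hsum⟩ := hstep.sum_eq (by rw [List.length_take]; omega)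
      rw [← heq] at hsum
      linarith
    rw [if_neg hne]
    exact h.append hstep (by rw [List.length_take]; omega)
      (fun a ha => hpos' a (List.mem_of_mem_take ha)) hratio
  · have htake : (mergeAt A g).take p = A.take p :=
      take_mergeAt_of_le (by omega) (by omega)
    rw [htake, if_pos h.last]
    exact h

theorem foldl_range_induction {σ : Type*} {f : σ → ℕ → σ} (P : ℕ → σ → Prop) {n : ℕ} {s : σ}
    (h0 : P 0 s) (hs : ∀ i < n, ∀ s, P i s → P (i + 1) (f s i)) :
    P n ((List.range n).foldl f s) := by
  induction n with
  | zero => simpa using h0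
  | succ n ih =>
    rw [List.range_succ, List.foldl_append, List.foldl_cons, List.foldl_nil]
    exact hs n (by omega) _ (ih fun i hi => hs i (by omega))

theorem configsInv_round {p : ℕ} {α : ℝ} (hα : 0 < α) {q m : ℕ}
    (hq : q = 2 ∨ q = 4 ∨ 8 ≤ q) (hqp : q ≤ p) (hm : 2 * m + 2 ≤ q)
    {st : SchemeState} (hst : st.parts = schemeParts p α q m 0)
    (h : ConfigsInv p (ratioBound p) ((schemeParts p α q m 0).flatten.take p) st.configs) :
    ((List.range p).foldl (schemeStep p) st).parts = schemeParts p α q (m + 1) 0 ∧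
      ConfigsInv p (ratioBound p) ((schemeParts p α q (m + 1) 0).flatten.take p)
        ((List.range p).foldl (schemeStep p) st).configs := by
  rw [← schemeParts_full]
  exact foldl_range_induction (f := schemeStep p)
    (fun i s => s.parts = schemeParts p α q m i ∧
      ConfigsInv p (ratioBound p) ((schemeParts p α q m i).flatten.take p) s.configs)
    ⟨hst, h⟩ fun i hi s hs => configsInv_schemeStep hα hq hqp hm hi hs.1 hs.2

/-- The state of the scheme after `r` rounds. -/
def RoundInv (p r : ℕ) (st : SchemeState) : Prop :=
  ∃ (α : ℝ) (j q m : ℕ), 0 < α ∧ q = 2 ^ j ∧ q ≤ p ∧ (p : ℝ) ≤ α * q ∧ p + m = r + q ∧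
    (2 * m + 2 ≤ q ∨ q = 1 ∧ m = 0) ∧ st.parts = schemeParts p α q m 0 ∧
    ConfigsInv p (ratioBound p) ((schemeParts p α q m 0).flatten.take p) st.configs

/-- A round either merges one more pair in every super-partition or completes the phase, and then q
is halved and m reset to 0. Each super-partition has q − m = p − r entries after r rounds. The
invariant p ≤ αq survives halving because the scale at least doubles; it ends as α ≥ p, so the
scheme really grows. -/
theorem RoundInv.step {p r : ℕ} {st : SchemeState} (h : RoundInv p r st) (hr : r < p - 1) :
    RoundInv p (r + 1) ((List.range p).foldl (schemeStep p) st) := by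
  obtain ⟨α, j, q, m, hα, hj, hqp, hαq, hrq, hm, hparts, hconf⟩ := h
  have hm' : 2 * m + 2 ≤ q := by omega
  obtain ⟨j, rfl⟩ : ∃ i, j = i + 1 := ⟨j - 1, by
    rcases j with _ | j
    · simp at hj; omega
    · simp⟩
  rw [pow_succ'] at hj
  have hq : q = 2 ∨ q = 4 ∨ 8 ≤ q := by
    rcases j with _ | _ | j
    · left; simpa using hj
    · right; left; simpa using hj
    · right; right
      have : 1 ≤ 2 ^ j := Nat.one_le_two_pow
      rw [hj, pow_succ, pow_succ]; omega
  obtain ⟨h1, h2⟩ := configsInv_round hα hq hqp hm' hparts hconf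
  by_cases hnext : 2 * (m + 1) + 2 ≤ q
  · exact ⟨α, j + 1, q, m + 1, hα, by rw [hj, pow_succ'], hqp, hαq, by omega, Or.inl hnext, h1, h2⟩
  · have hqm : q = 2 * (m + 1) := by omega
    have hm1 : m + 1 = 2 ^ j := by omega
    have hone : (1 : ℝ) ≤ 2 ^ (1 / ((2 * (m + 1) : ℕ) : ℝ)) :=
      Real.one_le_rpow one_le_two (by positivity)
    rw [hqm, schemeParts_half (by omega)] at h1 h2
    refine ⟨_, j, m + 1, 0, by positivity, hm1, by omega, ?_, by omega, by omega, h1, h2⟩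
    rw [hqm] at hαq
    push_cast at hαq hone ⊢
    have : α * ((m : ℝ) + 1) * 1 ≤ α * ((m : ℝ) + 1) * 2 ^ (1 / (2 * ((m : ℝ) + 1))) := by
      gcongr
    nlinarith

/-- The configurations of the scheme: all of them satisfy the bound, each leads to the next one
by a step, and the last one is a multiple of the first one. -/
theorem configsInv_periodicScheme {p k : ℕ} (hp : p = 2 ^ k) (hp2 : 2 ≤ p) :
    ∃ α : ℝ, p ≤ α ∧ ConfigsInv p (ratioBound p) ((superPartition p 2 1).map (α * ·))
      (periodicScheme p 2) := by
  have hp4 : p = 2 ∨ p = 4 ∨ 8 ≤ p := by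
    rcases k with _ | _ | _ | k
    · simp at hp; omega
    · left; simpa using hp
    · right; left; simpa using hp
    · right; right
      have : 1 ≤ 2 ^ k := Nat.one_le_two_pow
      rw [hp, pow_succ, pow_succ, pow_succ]; omega
  have hfirst : (schemeParts p 1 p 0 0).flatten.take p = superPartition p 2 1 := by
    have h1 : schemePart p 1 p 0 0 0 = superPartition p 2 1 := by
      rw [schemePart, if_neg (lt_irrefl 0), ← superPartition_eq]
    obtain ⟨p', rfl⟩ : ∃ p', p = p' + 1 := ⟨p - 1, by omega⟩
    rw [schemeParts, List.range_succ_eq_map, List.map_cons, List.flatten_cons, h1]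
    exact List.take_left' (by simp [superPartition])
  have hinit : RoundInv p 0 (schemeInit p 2) := by
    refine ⟨1, k, p, 0, one_pos, hp, le_rfl, by simp, by omega, Or.inl (by omega),
      schemeInit_parts p, ?_⟩
    have hlen := length_flatten_schemeParts p 1 (q := p) (m := 0) (i := 0) (by omega) (by omega)
    have hratio := maxAvgRatio_take_le (p := p) one_pos (i := 0) (m := 0) hp4 le_rfl (by omega)
      (by omega)
    have hpos := pos_of_mem_flatten_schemeParts (p := p) one_pos p 0 0
    have hpos' : ∀ a ∈ (schemeParts p 1 p 0 0).flatten.take p, 0 < a :=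
      fun a ha => hpos a (List.mem_of_mem_take ha)
    rw [hfirst] at hratio hpos' ⊢
    simp only [schemeInit]
    constructor
    · rfl
    · rfl
    · simp
    · intro Y hY; rw [List.mem_singleton.1 hY]; simp [superPartition]
    · intro Y hY; rw [List.mem_singleton.1 hY]; exact hpos'
    · intro Y hY; rw [List.mem_singleton.1 hY]; exact hratio
  have hfinal := foldl_range_induction (f := fun st _ => (List.range p).foldl (schemeStep p) st)
    (RoundInv p) (n := p - 1) hinit fun r hr s hs => hs.step hr
  obtain ⟨α, j, q, m, hα, hj, hqp, hαq, hrq, hm, hparts, hconf⟩ := hfinal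
  -- After p − 1 rounds q − m = 1, which excludes 2m + 2 ≤ q.
  obtain ⟨rfl, rfl⟩ : q = 1 ∧ m = 0 := by omega
  refine ⟨α, by simpa using hαq, ?_⟩
  have hlast : (schemeParts p α 1 0 0).flatten.take p = (superPartition p 2 1).map (α * ·) := by
    have h1 : (schemeParts p α 1 0 0).flatten = (superPartition p 2 1).map (α * ·) := by
      rw [schemeParts, superPartition, List.map_map]
      have : ∀ b, schemePart p α 1 0 0 b =
          [((α * ·) ∘ fun j : ℕ => (2 : ℝ) ^ (((1 + j : ℕ) : ℝ) / (p : ℝ))) b] := by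
        intro b
        simp [schemePart, pairMerged, geomWeight, add_comm]
      rw [funext this]
      generalize List.range p = l
      induction l with
      | nil => rfl
      | cons a l ih => rw [List.map_cons, List.flatten_cons, ih, List.map_cons]; rfl
    rw [h1]
    exact List.take_of_length_le (by simp [superPartition])
  rw [hlast] at hconf
  exact hconf

/-! ## Flow algorithms from sequences of configurations -/

/-- A sequence of configurations of `p` parts, in which separators are only removed or inserted at
the current time. -/
structure FlowSchedule (p : ℕ) (Y : ℕ → List ℝ) : Prop where
  length_eq : ∀ k, (Y k).length = p
  nonneg : ∀ k, ∀ a ∈ Y k, 0 ≤ a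
  sum_strictMono : StrictMono fun k => (Y k).sum
  nested : ∀ k i, 1 ≤ i → i < p →
    ∃ i', 1 ≤ i' ∧ i' ≤ p ∧ ((Y (k + 1)).take i).sum = ((Y k).take i').sum
  unbounded : ∀ t : ℝ, ∃ k, t < (Y k).sum

theorem sum_take_mono {l : List ℝ} (hl : ∀ a ∈ l, 0 ≤ a) {i j : ℕ} (h : i ≤ j) :
    (l.take i).sum ≤ (l.take j).sum := by
  have : l.take j = l.take i ++ (l.drop i).take (j - i) := by
    rw [← List.take_add, Nat.add_sub_cancel' h]
  rw [this, List.sum_append]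
  have : 0 ≤ ((l.drop i).take (j - i)).sum :=
    List.sum_nonneg fun a ha => hl a (List.mem_of_mem_drop (List.mem_of_mem_take ha))
  linarith

theorem sum_take_le_sum {l : List ℝ} (hl : ∀ a ∈ l, 0 ≤ a) (i : ℕ) : (l.take i).sum ≤ l.sum := by
  rcases le_total i l.length with h | h
  · simpa using sum_take_mono hl h
  · rw [List.take_of_length_le h]

namespace FlowSchedule

variable {p : ℕ} {Y : ℕ → List ℝ}

theorem sum_take_le (S : FlowSchedule p Y) (k : ℕ) {i : ℕ} (hi : i < p) :
    ((Y (k + 1)).take i).sum ≤ (Y k).sum := by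
  rcases Nat.eq_zero_or_pos i with rfl | h
  · simpa using List.sum_nonneg (S.nonneg k)
  · obtain ⟨i', -, -, h'⟩ := S.nested k i h hi
    rw [h']
    exact sum_take_le_sum (S.nonneg k) i'

/-- A separator of a later configuration is traced back step by step. The index i' = p would mean
that it was inserted at the total weight of an intermediate configuration, which is at least the
total of `Y k`. -/
theorem nested_add (S : FlowSchedule p Y) (k d : ℕ) {i : ℕ} (hi1 : 1 ≤ i) (hi : i < p)
    (hlt : ((Y (k + d)).take i).sum < (Y k).sum) :
    ∃ i', 1 ≤ i' ∧ i' < p ∧ ((Y (k + d)).take i).sum = ((Y k).take i').sum := by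
  induction d generalizing i with
  | zero => exact ⟨i, hi1, hi, rfl⟩
  | succ d ih =>
    obtain ⟨i', h1, h2, h3⟩ := S.nested (k + d) i hi1 hi
    rw [← add_assoc] at hlt ⊢
    rw [h3] at hlt ⊢
    rcases h2.lt_or_eq with h2 | rfl
    · exact ih h1 h2 hlt
    · rw [List.take_of_length_le (S.length_eq _).le] at hlt
      exact absurd hlt (not_lt.2 (S.sum_strictMono.monotone (Nat.le_add_right k d)))

open Classical in
/-- The first configuration of total weight more than `t`. -/
def stage (S : FlowSchedule p Y) (t : ℝ) : ℕ := Nat.find (S.unbounded t)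

theorem lt_sum_stage (S : FlowSchedule p Y) (t : ℝ) : t < (Y (S.stage t)).sum := by
  classical exact Nat.find_spec (S.unbounded t)

theorem stage_le (S : FlowSchedule p Y) {t : ℝ} {k : ℕ} (h : t < (Y k).sum) : S.stage t ≤ k := by
  classical exact Nat.find_min' (S.unbounded t) h

theorem stage_mono (S : FlowSchedule p Y) {s t : ℝ} (h : s ≤ t) : S.stage s ≤ S.stage t :=
  S.stage_le (h.trans_lt (S.lt_sum_stage t))

theorem stage_eq (S : FlowSchedule p Y) {t : ℝ} {k : ℕ} (h1 : (Y k).sum ≤ t)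
    (h2 : t < (Y (k + 1)).sum) : S.stage t = k + 1 := by
  apply le_antisymm (S.stage_le h2)
  by_contra! h
  have := S.sum_strictMono.monotone (Nat.le_of_lt_succ h)
  linarith [S.lt_sum_stage t]

/-- The partitioning at time `t`. -/
def conf (S : FlowSchedule p Y) (hp : 0 < p) (t : ℝ≥0) : FlowPartition p (t : ℝ) where
  -- The cap at t acts only before the total of `Y 0` is reached; afterwards all inner separators of
  -- the current stage lie below t by `sum_take_le`.
  sep j := if j = Fin.last p then (t : ℝ) else min ((Y (S.stage t)).take j).sum t
  mono := by
    intro i j hij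
    dsimp only
    split_ifs with h1 h2 h2
    · exact le_rfl
    · exact absurd (h1 ▸ Fin.le_last j) (fun hj => h2 (le_antisymm hj (h1 ▸ hij)))
    · exact min_le_right _ _
    · exact min_le_min_right _ (sum_take_mono (S.nonneg _) hij)
  sep_zero := by
    rw [if_neg]
    · simp
    · intro h
      have := congrArg Fin.val h
      simp at this
      omega
  sep_last := by simp

theorem conf_sep (S : FlowSchedule p Y) (hp : 0 < p) (t : ℝ≥0) {j : Fin (p + 1)}
    (hj : j ≠ Fin.last p) : (S.conf hp t).sep j = min ((Y (S.stage t)).take j).sum t :=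
  if_neg hj

/-- The online algorithm that runs through the given configurations. -/
def algorithm (S : FlowSchedule p Y) (hp : 0 < p) : FlowAlgorithm p where
  conf := S.conf hp
  online := by
    intro s t hst i hi0 hil hle
    rcases hst.eq_or_lt with rfl | hlt
    · exact ⟨i, hi0, hil, rfl⟩
    have hlt' : (s : ℝ) < t := by exact_mod_cast hlt
    rw [S.conf_sep hp t hil] at hle ⊢
    have h1 : ((Y (S.stage t)).take i).sum ≤ s := by
      rcases min_le_iff.1 hle with h | h
      · exact h
      · linarith
    rw [min_eq_left (by linarith)]
    have hmono := S.stage_mono hlt'.le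
    obtain ⟨d, hd⟩ := Nat.exists_eq_add_of_le hmono
    have hi1 : 1 ≤ (i : ℕ) := Nat.one_le_iff_ne_zero.2 fun h => hi0 (Fin.ext h)
    have hip : (i : ℕ) < p := lt_of_le_of_ne (Nat.le_of_lt_succ i.2) fun h => hil (Fin.ext h)
    rw [hd] at h1 ⊢
    obtain ⟨i', h2, h3, h4⟩ := S.nested_add _ d hi1 hip (h1.trans_lt (S.lt_sum_stage s))
    have hl : (⟨i', by omega⟩ : Fin (p + 1)) ≠ Fin.last p := fun h => by
      have := congrArg Fin.val h
      simp at this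
      omega
    refine ⟨⟨i', by omega⟩, fun h => ?_, hl, ?_⟩
    · have := congrArg Fin.val h
      simp at this
      omega
    · rw [S.conf_sep hp s hl, ← h4, min_eq_left h1]

theorem weight_algorithm (S : FlowSchedule p Y) (hp : 0 < p) {k : ℕ} {t : ℝ≥0}
    (h1 : (Y k).sum ≤ t) (h2 : t < (Y (k + 1)).sum) {j : Fin p} (hj : (j : ℕ) + 1 < p) :
    ((S.algorithm hp).conf t).weight j = (Y (k + 1)).getD j 0 := by
  have hl1 : j.succ ≠ Fin.last p := fun h => by
    have := congrArg Fin.val h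
    simp at this
    omega
  have hl2 : j.castSucc ≠ Fin.last p := (Fin.castSucc_lt_last j).ne
  have h3 := S.sum_take_le k hj
  have h4 := S.sum_take_le k j.2
  change (S.conf hp t).sep _ - (S.conf hp t).sep _ = _
  rw [S.conf_sep hp t hl1, S.conf_sep hp t hl2, S.stage_eq h1 h2, Fin.val_succ, Fin.val_castSucc,
    min_eq_left (h3.trans h1), min_eq_left (h4.trans h1),
    List.sum_take_succ _ _ (by rw [S.length_eq]; exact j.2), List.getD_eq_getElem _ _ (by rw [S.length_eq]; exact j.2)]
  ring

/-- The first p − 1 parts already have their weights in `Y (k + 1)`, and the last part is still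
filling up to its weight there. -/
theorem bottleneck_algorithm_le (S : FlowSchedule p Y) (hp : 0 < p) {k : ℕ} {t : ℝ≥0}
    (h1 : (Y k).sum ≤ t) (h2 : t < (Y (k + 1)).sum) :
    ((S.algorithm hp).conf t).bottleneck ≤ listMax (Y (k + 1)) := by
  have : Nonempty (Fin p) := ⟨⟨0, hp⟩⟩
  apply ciSup_le
  intro j
  have hjl : (j : ℕ) < (Y (k + 1)).length := by rw [S.length_eq]; exact j.2
  refine le_trans ?_ (le_listMax (List.getElem_mem hjl))
  by_cases hj : (j : ℕ) + 1 < p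
  · rw [S.weight_algorithm hp h1 h2 hj, List.getD_eq_getElem _ _ hjl]
  · have hs : j.succ = Fin.last p := Fin.ext (by simp; omega)
    have h4 := S.sum_take_le k j.2
    have h5 := List.sum_take_succ (Y (k + 1)) j hjl
    rw [List.take_of_length_le (by rw [S.length_eq]; omega)] at h5
    change (S.conf hp t).sep _ - (S.conf hp t).sep _ ≤ _
    rw [hs, (S.conf hp t).sep_last, S.conf_sep hp t (Fin.castSucc_lt_last j).ne,
      S.stage_eq h1 h2, Fin.val_castSucc, min_eq_left (h4.trans h1)]
    linarith

end FlowSchedule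

/-! ### The averaging bound for the optimum, and the case of a single part -/

theorem FlowPartition.sum_weight {p : ℕ} {t : ℝ} (P : FlowPartition p t) :
    ∑ j, P.weight j = t := by
  obtain ⟨f, hf⟩ : ∃ f : ℕ → ℝ, ∀ j : Fin (p + 1), P.sep j = f j :=
    ⟨fun n => if h : n < p + 1 then P.sep ⟨n, h⟩ else 0, fun j => by simp [j.2]⟩
  have h : ∀ j : Fin p, P.weight j = f (j + 1) - f j := fun j => by
    rw [FlowPartition.weight, hf, hf, Fin.val_succ, Fin.val_castSucc]
  have h0 := P.sep_zero
  have h1 := P.sep_last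
  rw [hf] at h0 h1
  rw [Finset.sum_congr rfl fun j _ => h j, Fin.sum_univ_eq_sum_range (fun n => f (n + 1) - f n),
    Finset.sum_range_sub]
  simp only [Fin.val_last, Fin.val_zero] at h0 h1
  rw [h0, h1, sub_zero]

theorem FlowPartition.le_bottleneck {p : ℕ} {t : ℝ} (P : FlowPartition p t) :
    t ≤ p * P.bottleneck := by
  have h := Finset.sum_le_card_nsmul Finset.univ P.weight P.bottleneck
    fun j _ => le_ciSup (Set.finite_range _).bddAbove j
  rw [P.sum_weight] at h
  simpa using h

theorem div_le_flowOpt {p : ℕ} (hp : 0 < p) {t : ℝ} [Nonempty (FlowPartition p t)] :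
    t / p ≤ flowOpt p t := by
  apply le_csInf (Set.range_nonempty _)
  rintro _ ⟨P, rfl⟩
  rw [div_le_iff₀' (by exact_mod_cast hp)]
  exact P.le_bottleneck

/-- The trivial algorithm for one part. -/
def trivialAlgorithm : FlowAlgorithm 1 where
  conf t :=
    { sep := fun j => if j = 0 then 0 else t
      mono := by
        intro i j hij
        dsimp only
        split_ifs with h1 h2 h2
        · exact le_rfl
        · exact t.2
        · exact absurd (le_antisymm (h2 ▸ hij) (Fin.zero_le i)) h1
        · exact le_rfl
      sep_zero := if_pos rfl
      sep_last := if_neg (by decide) }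
  online := by
    intro s t _ i h0 h1
    exfalso
    fin_cases i
    · exact h0 rfl
    · exact h1 rfl

theorem trivialAlgorithm_isCompetitive (t₀ : ℝ≥0) {c : ℝ} (hc : 1 ≤ c) :
    trivialAlgorithm.IsCompetitive t₀ c := by
  intro t _
  have : Nonempty (FlowPartition 1 (t : ℝ)) := ⟨trivialAlgorithm.conf t⟩
  have h1 := div_le_flowOpt (p := 1) one_pos (t := t)
  rw [Nat.cast_one, div_one] at h1
  have h2 : (trivialAlgorithm.conf t).bottleneck ≤ t := by
    apply ciSup_le
    intro j
    have := (trivialAlgorithm.conf t).sum_weight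
    rw [Fin.sum_univ_one] at this
    rw [Subsingleton.elim j 0]
    exact this.le
  have h3 : (0 : ℝ) ≤ t := t.2
  nlinarith

/-! ## Running the periodic scheme -/

theorem listMax_map_mul_le {X : List ℝ} {c : ℝ} (hc : 0 ≤ c) (hX : ∀ a ∈ X, 0 < a) :
    listMax (X.map (c * ·)) ≤ c * listMax X := by
  have h0 : 0 ≤ listMax X := by
    cases X with
    | nil => exact le_rfl
    | cons a X => exact (hX a (by simp)).le.trans (le_listMax (by simp))
  apply listMax_le (mul_nonneg hc h0)
  intro a ha
  obtain ⟨b, hb, rfl⟩ := List.mem_map.1 ha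
  exact mul_le_mul_of_nonneg_left (le_listMax hb) hc

theorem sum_map_mul (X : List ℝ) (c : ℝ) : (X.map (c * ·)).sum = c * X.sum := by
  simpa using List.sum_map_mul_left X id c

theorem take_map_mul_sum (X : List ℝ) (c : ℝ) (i : ℕ) :
    ((X.map (c * ·)).take i).sum = c * (X.take i).sum := by
  rw [← List.map_take, sum_map_mul]

/-- A finite sequence of configurations, the last of which is a multiple of the first one, can be
run forever. -/
theorem exists_flowAlgorithm_of_configs {p : ℕ} (hp : 0 < p) {cs : List (List ℝ)} {α : ℝ}
    (hα : 1 < α) (hchain : cs.IsChain (FlowStep p)) (hlen : ∀ X ∈ cs, X.length = p)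
    (hpos : ∀ X ∈ cs, ∀ a ∈ X, 0 < a) (hne : cs ≠ [])
    (hlast : cs.getD (cs.length - 1) [] = (cs.getD 0 []).map (α * ·)) (t₀ : ℝ≥0) (ht₀ : 0 < t₀) :
    ∃ A : FlowAlgorithm p,
      (∀ n i : ℕ, i + 1 < cs.length → ∀ t : ℝ≥0,
        (t₀ : ℝ) / (cs.getD 0 []).sum * α ^ n * (cs.getD i []).sum ≤ t →
        t < (t₀ : ℝ) / (cs.getD 0 []).sum * α ^ n * (cs.getD (i + 1) []).sum →
        ∀ j : Fin p, (j : ℕ) + 1 < p → (A.conf t).weight j =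
          (t₀ : ℝ) / (cs.getD 0 []).sum * α ^ n * (cs.getD (i + 1) []).getD j 0) ∧
      ∀ R : ℝ, (∀ X ∈ cs, maxAvgRatio X ≤ R) →
        A.IsCompetitive t₀ (((p : ℝ) + 4) / p * R) := by
  set X : ℕ → List ℝ := fun i => cs.getD i [] with hXdef
  have hp0 : (0 : ℝ) < p := by exact_mod_cast hp
  have hN : 0 < cs.length := List.length_pos_iff.2 hne
  have hmem : ∀ i < cs.length, X i ∈ cs := fun i hi => by
    simp only [hXdef]
    rw [List.getD_eq_getElem _ _ hi]
    exact List.getElem_mem hi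
  have hsumpos : ∀ i < cs.length, 0 < (X i).sum := fun i hi =>
    List.sum_pos _ (hpos _ (hmem i hi))
      (List.length_pos_iff.1 (by rw [hlen _ (hmem i hi)]; exact hp))
  have hstep : ∀ i, i + 1 < cs.length → FlowStep p (X i) (X (i + 1)) := fun i hi => by
    simp only [hXdef]
    rw [List.getD_eq_getElem _ _ hi, List.getD_eq_getElem _ _ (by omega)]
    exact List.isChain_iff_getElem.1 hchain i hi
  set M := cs.length - 1 with hM
  have hX0 := hsumpos 0 hN
  have hM1 : 1 ≤ M := by
    by_contra! h
    have h0 : M = 0 := by omega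
    have h1 := congrArg List.sum hlast
    rw [h0, sum_map_mul] at h1
    change (X 0).sum = α * (X 0).sum at h1
    nlinarith
  have ht : (0 : ℝ) < t₀ := ht₀
  set scale : ℕ → ℝ := fun n => (t₀ : ℝ) / (X 0).sum * α ^ n with hscale
  have hscale0 : ∀ n, 0 < scale n := fun n => by
    have : 0 < α := by linarith
    simp only [hscale]; positivity
  -- The period is M = N − 1: the last configuration of a repetition is the first one of the next.
  set Y : ℕ → List ℝ := fun k => (X (k % M)).map (scale (k / M) * ·) with hY
  have hY1 : ∀ n i, i < M → Y (M * n + i) = (X i).map (scale n * ·) := fun n i hi => by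
    simp only [hY]
    rw [Nat.mul_add_mod, Nat.mod_eq_of_lt hi, Nat.mul_add_div (by omega), Nat.div_eq_of_lt hi,
      add_zero]
  have hY2 : ∀ n i, i < M → Y (M * n + i + 1) = (X (i + 1)).map (scale n * ·) := fun n i hi => by
    rcases Nat.lt_or_ge (i + 1) M with h | h
    · exact hY1 n (i + 1) h
    · have hi' : i + 1 = M := by omega
      have e : M * n + i + 1 = M * (n + 1) + 0 := by rw [mul_add]; omega
      rw [e, hY1 (n + 1) 0 (by omega), hi']
      change _ = (cs.getD M []).map _
      rw [hlast, List.map_map]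
      apply List.map_congr_left
      intro a _
      simp only [hscale, Function.comp_apply, pow_succ]
      ring
  have hdecomp : ∀ k, ∃ n i, i < M ∧ k = M * n + i := fun k =>
    ⟨k / M, k % M, Nat.mod_lt _ (by omega), (Nat.div_add_mod k M).symm⟩
  have hYmem : ∀ k, ∃ c, 0 < c ∧ ∃ Z ∈ cs, Y k = Z.map (c * ·) := fun k =>
    ⟨_, hscale0 _, X (k % M), hmem _ (by have := Nat.mod_lt k (show M > 0 by omega); omega), rfl⟩
  have hYstep : ∀ k, ∃ c, 0 < c ∧ ∃ Z ∈ cs, ∃ Z' ∈ cs, FlowStep p Z Z' ∧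
      Y k = Z.map (c * ·) ∧ Y (k + 1) = Z'.map (c * ·) := by
    intro k
    obtain ⟨n, i, hi, rfl⟩ := hdecomp k
    exact ⟨scale n, hscale0 n, X i, hmem i (by omega), X (i + 1), hmem _ (by omega),
      hstep i (by omega), hY1 n i hi, hY2 n i hi⟩
  have S : FlowSchedule p Y := by
    refine ⟨fun k => ?_, fun k a ha => ?_, strictMono_nat_of_lt_succ fun k => ?_,
      fun k i hi1 hi => ?_, fun t => ?_⟩
    · obtain ⟨c, -, Z, hZ, h⟩ := hYmem k
      rw [h, List.length_map, hlen Z hZ]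
    · obtain ⟨c, hc, Z, hZ, h⟩ := hYmem k
      rw [h] at ha
      obtain ⟨b, hb, rfl⟩ := List.mem_map.1 ha
      exact mul_nonneg hc.le (hpos Z hZ b hb).le
    · obtain ⟨c, hc, Z, hZ, Z', hZ', hs, h1, h2⟩ := hYstep k
      obtain ⟨e, he, -, hsum⟩ := hs.sum_eq (hlen Z hZ)
      rw [h1, h2, sum_map_mul, sum_map_mul, hsum]
      exact mul_lt_mul_of_pos_left (by linarith) hc
    · obtain ⟨c, hc, Z, hZ, Z', hZ', hs, h1, h2⟩ := hYstep k
      obtain ⟨i', h3, h4, h5⟩ := hs.sum_take (hlen Z hZ) hi1 hi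
      exact ⟨i', h3, h4, by rw [h1, h2, take_map_mul_sum, take_map_mul_sum, h5]⟩
    · obtain ⟨n, hn⟩ := pow_unbounded_of_one_lt (t / t₀) hα
      refine ⟨M * n + 0, ?_⟩
      rw [hY1 n 0 (by omega), sum_map_mul]
      rw [div_lt_iff₀ ht] at hn
      have : scale n * (X 0).sum = α ^ n * t₀ := by
        simp only [hscale]; field_simp
      linarith
  refine ⟨S.algorithm hp, fun n i hi t h1 h2 j hj => ?_, fun R hR t htt => ?_⟩
  · have e1 := hY1 n i (by omega)
    have e2 := hY2 n i (by omega)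
    have hj' : (j : ℕ) < (X (i + 1)).length := by
      rw [hlen _ (hmem _ (by omega))]; exact j.2
    rw [S.weight_algorithm hp (k := M * n + i) (by rw [e1, sum_map_mul]; exact h1)
      (by rw [e2, sum_map_mul]; exact h2) hj, e2, List.getD_eq_getElem _ _ (by simpa using hj'),
      List.getElem_map]
    change scale n * (X (i + 1))[(j : ℕ)] = scale n * (X (i + 1)).getD j 0
    rw [List.getD_eq_getElem _ _ hj']
  · have : Nonempty (FlowPartition p (t : ℝ)) := ⟨S.conf hp t⟩
    have hY0 : (Y 0).sum = t₀ := by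
      have e := hY1 0 0 (by omega)
      rw [mul_zero, zero_add] at e
      rw [e, sum_map_mul]
      simp only [hscale, pow_zero, mul_one]
      field_simp
    have hstage : S.stage t ≠ 0 := fun h => by
      have h1 := S.lt_sum_stage t
      rw [h, hY0] at h1
      have : (t₀ : ℝ) ≤ t := htt
      linarith
    obtain ⟨k, hk⟩ := Nat.exists_eq_succ_of_ne_zero hstage
    have hlow : (Y k).sum ≤ t := by
      by_contra! h
      have := S.stage_le h
      omega
    have hup : (t : ℝ) < (Y (k + 1)).sum := by
      have := S.lt_sum_stage t
      rwa [hk] at this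
    refine (S.bottleneck_algorithm_le hp hlow hup).trans ?_
    obtain ⟨c, hc, Z, hZ, Z', hZ', hs, e1, e2⟩ := hYstep k
    obtain ⟨e, he, hle, hsum⟩ := hs.sum_eq (hlen Z hZ)
    have hZpos : 0 < Z.sum := List.sum_pos _ (hpos _ hZ)
      (List.length_pos_iff.1 (by rw [hlen _ hZ]; exact hp))
    rw [e1, sum_map_mul] at hlow
    rw [e2]
    refine (listMax_map_mul_le hc.le (hpos Z' hZ')).trans ?_
    have hmax : listMax Z' = maxAvgRatio Z' * ((Z.sum + e) / p) := by
      rw [maxAvgRatio, listAvg, hlen Z' hZ', hsum, div_mul_cancel₀]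
      positivity
    have hrat0 : 0 ≤ maxAvgRatio Z' := by
      by_contra! h
      have h1 : listMax Z' < 0 := by
        rw [hmax]; exact mul_neg_of_neg_of_pos h (by positivity)
      have h2 : 0 < Z'.length := by rw [hlen Z' hZ']; exact hp
      have h3 := List.getElem_mem h2
      linarith [le_listMax h3, hpos Z' hZ' _ h3]
    have hR0 : 0 ≤ R := hrat0.trans (hR Z' hZ')
    -- The arriving weight is at most 4/p of the total; this is the source of the factor (p + 4)/p.
    have hgrow : Z.sum + e ≤ (p + 4) / p * Z.sum := by
      rw [div_mul_eq_mul_div, le_div_iff₀ hp0]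
      linarith
    calc c * listMax Z' ≤ c * (R * ((p + 4) / p * Z.sum / p)) := by
          rw [hmax]
          have := hR Z' hZ'
          gcongr
      _ = (p + 4) / p * R * (c * Z.sum / p) := by ring
      _ ≤ (p + 4) / p * R * (t / p) := by gcongr
      _ ≤ (p + 4) / p * R * flowOpt p t := by
          have := div_le_flowOpt (t := t) hp
          gcongr

/-! ### Constants and conclusion -/

theorem FlowAlgorithm.IsCompetitive.mono {p : ℕ} (hp : 0 < p) {A : FlowAlgorithm p} {t₀ : ℝ≥0}
    {c d : ℝ} (h : A.IsCompetitive t₀ c) (hcd : c ≤ d) : A.IsCompetitive t₀ d := by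
  intro t ht
  have : Nonempty (FlowPartition p (t : ℝ)) := ⟨A.conf t⟩
  have h0 : 0 ≤ flowOpt p (t : ℝ) :=
    (by positivity : (0 : ℝ) ≤ t / p).trans (div_le_flowOpt hp)
  exact (h t ht).trans (mul_le_mul_of_nonneg_right hcd h0)

theorem periodicScheme_one : periodicScheme 1 2 = [[2]] := by
  simp [periodicScheme, schemeInit, superPartition]

theorem maxAvgRatio_singleton_two : maxAvgRatio [2] = 1 := by
  norm_num [maxAvgRatio, listMax, listAvg]

/-- With r = 1/p, A = 16384² and K the limit, (1 + 4r)(K + Ar) has the error terms 4Kr ≤ 8r and Ar +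
4Ar² ≤ 5Ar. -/
theorem ratioBound_mul_le {p : ℕ} (hp : 0 < p) :
    ((p : ℝ) + 4) / p * ratioBound p ≤ limitRatio + (5 * 16384 ^ 2 + 8) / p := by
  have hp0 : (0 : ℝ) < p := by exact_mod_cast hp
  have hr : 1 / (p : ℝ) ≤ 1 := by
    rw [div_le_one hp0]; exact_mod_cast hp
  have hr0 : 0 ≤ 1 / (p : ℝ) := by positivity
  have e1 : ((p : ℝ) + 4) / p = 1 + 4 * (1 / p) := by field_simp
  have e2 : (16384 : ℝ) ^ 2 / p = 16384 ^ 2 * (1 / p) := by ring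
  have e3 : (5 * 16384 ^ 2 + 8 : ℝ) / p = (5 * 16384 ^ 2 + 8) * (1 / p) := by ring
  rw [ratioBound, e1, e2, e3]
  set r := 1 / (p : ℝ)
  have h1 : limitRatio * r ≤ 2 * r := by
    gcongr; linarith [limitRatio_bounds.2]
  have h2 : r * r ≤ r := mul_le_of_le_one_right hr0 hr
  nlinarith

theorem mainTheorem1 :
    |Real.log 2 / (√2 - 1) - 1.673| < 0.0005 ∧
    ∃ C : ℝ, ∀ k p : ℕ, p = 2 ^ k →
      (∀ X ∈ periodicScheme p 2,
        maxAvgRatio X ≤ Real.log 2 / (√2 - 1) + C / (p : ℝ)) ∧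
      (∀ t₀ : ℝ≥0, 0 < t₀ → ∃ A : FlowAlgorithm p,
        A.RunsScheme 2 t₀ ∧
        A.IsCompetitive t₀ (((p : ℝ) + 4) / (p : ℝ) * schemeRatio p 2) ∧
        A.IsCompetitive t₀ (Real.log 2 / (√2 - 1) + C / (p : ℝ))) := by
  refine ⟨abs_limitRatio_sub_lt, 5 * 16384 ^ 2 + 8, fun k p hpk => ?_⟩
  change (∀ X ∈ periodicScheme p 2, maxAvgRatio X ≤ limitRatio + _) ∧
    (∀ t₀ : ℝ≥0, 0 < t₀ → ∃ A : FlowAlgorithm p, A.RunsScheme 2 t₀ ∧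
      A.IsCompetitive t₀ _ ∧ A.IsCompetitive t₀ (limitRatio + _))
  have hK := limitRatio_bounds
  have hp : 0 < p := by rw [hpk]; positivity
  rcases (Nat.succ_le_of_lt hp).eq_or_lt with h | hp2
  -- For p = 1 there is a single configuration, so running the scheme is no condition.
  · obtain rfl : p = 1 := h.symm
    refine ⟨fun X hX => ?_, fun t₀ _ => ⟨trivialAlgorithm, ?_, ?_, ?_⟩⟩
    · rw [periodicScheme_one, List.mem_singleton] at hX
      rw [hX, maxAvgRatio_singleton_two]
      norm_num
      linarith
    · unfold FlowAlgorithm.RunsScheme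
      intro N X scale n i hi
      simp only [N, periodicScheme_one, List.length_singleton] at hi
      omega
    · apply trivialAlgorithm_isCompetitive
      rw [schemeRatio, periodicScheme_one, List.map_singleton, maxAvgRatio_singleton_two]
      norm_num [listMax]
    · apply trivialAlgorithm_isCompetitive
      norm_num
      linarith
  · have hp0 : (0 : ℝ) < p := by exact_mod_cast hp
    have hp2' : (2 : ℝ) ≤ p := by exact_mod_cast hp2
    obtain ⟨α, hα, hinv⟩ := configsInv_periodicScheme hpk hp2
    refine ⟨fun X hX => (hinv.ratio_le X hX).trans ?_, fun t₀ ht₀ => ?_⟩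
    · rw [ratioBound]
      gcongr
      norm_num
    have hne : periodicScheme p 2 ≠ [] := fun h => by
      have := hinv.last
      rw [h] at this
      simp at this
    have h0 : (periodicScheme p 2).getD 0 [] = superPartition p 2 1 := by
      have := hinv.head
      rw [List.head?_eq_getElem?] at this
      rw [List.getD_eq_getElem?_getD, this]
      rfl
    have hN : (periodicScheme p 2).getD ((periodicScheme p 2).length - 1) [] =
        (superPartition p 2 1).map (α * ·) := by
      have := hinv.last
      rw [List.getLast?_eq_getElem?] at this
      rw [List.getD_eq_getElem?_getD, this]
      rfl
    obtain ⟨A, hruns, hcomp⟩ := exists_flowAlgorithm_of_configs hp (by linarith : 1 < α) hinv.chain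
      hinv.length_eq hinv.pos hne (by rw [hN, h0]) t₀ ht₀
    have hfirst : superPartition p 2 1 ∈ periodicScheme p 2 := List.mem_of_mem_head? hinv.head
    have hS0 : 0 < (superPartition p 2 1).sum := List.sum_pos _ (hinv.pos _ hfirst)
      (List.length_pos_iff.1 (by rw [hinv.length_eq _ hfirst]; exact hp))
    refine ⟨A, ?_, ?_, ?_⟩
    · unfold FlowAlgorithm.RunsScheme
      intro N X scale n i hi
      have hscale : scale n = (t₀ : ℝ) / ((periodicScheme p 2).getD 0 []).sum * α ^ n := by
        simp only [scale, X, N, hN, h0, sum_map_mul]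
        rw [mul_div_cancel_right₀ _ hS0.ne']
      rw [hscale]
      exact hruns n i hi
    · exact hcomp _ fun X hX => le_listMax (List.mem_map_of_mem hX)
    · exact (hcomp _ hinv.ratio_le).mono hp (ratioBound_mul_le hp)

end
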